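/- Let $n\ge 1$ and let $M\in\mathrm{Sp}(2n,\mathbb R)$ be hyperbolic, i.e. without complex eigenvalues on the unit circle. For $N\in\mathbb N^*$ put $h=(2\pi N)^{-1}$, and call a unitary operator $M_N$ on $L^2(\mathbb R^n)$ a metaplectic operator (attached to $M$ and $N$) if $M_N^{-1}\,\mathrm{Op}_h(a)\,M_N=\mathrm{Op}_h(a\circ M)$ for every $a\in S(1)$. Here $S(1)$ is the set of smooth functions $a:\mathbb R^{2n}\to\mathbb C$ all of whose derivatives (including $a$ itself) are bounded, and $\mathrm{Op}_h(a)$ is the bounded operator on $L^2(\mathbb R^n)$ given for $u\in\mathcal S(\mathbb R^n)$ by the Weyl formula $$[\mathrm{Op}_h(a)u](x)=(2\pi h)^{-n}\iint e^{\frac ih\langle \xi,x-y\rangle}\,a\!\left(\tfrac{x+y}{2},\xi\right)u(y)\,dy\,d\xi .$$ Then there exists $E\in\mathrm{GL}(n,\mathbb R)$ which is expanding, i.e. $\|E^{-1}\|<1$ for the Euclidean operator norm, with $|\det E|>1$, such that for every $N\in\mathbb N^*$ and every metaplectic operator $M_N$ attached to $M$ and $N$ the following holds, where $L_Eu:=u\circ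 E^{-1}$ (so that $|\det E|^{-1/2}L_E$ is unitary on $L^2(\mathbb R^n)$): 1. $M_N$ is unitarily equivalent to $|\det E|^{-1/2}L_E$: there is a unitary operator $V$ on $L^2(\mathbb R^n)$ with $V M_N V^{-1}=|\det E|^{-1/2}L_E$; 2. up to a complex phase, the equivalence can be chosen to preserve the Schwartz space: there are $c\in\mathbb C$ with $|c|=1$ and a unitary operator $U$ on $L^2(\mathbb R^n)$ with $U(\mathcal S(\mathbb R^n))=\mathcal S(\mathbb R^n)$ and $U\,(c\,M_N)\,U^{-1}=|\det E|^{-1/2}L_E$. -/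

import Mathlib

open MeasureTheory
open scoped ContDiff Matrix

/-- Configuration space `ℝⁿ` with its Euclidean norm. -/
abbrev Conf (n : ℕ) : Type := EuclideanSpace ℝ (Fin n)

/-- Phase space `ℝ²ⁿ`, with coordinates `(x, ξ)`, `x, ξ ∈ ℝⁿ`. -/
abbrev Phase (n : ℕ) : Type := EuclideanSpace ℝ (Fin n ⊕ Fin n)

/-- The point `(x, ξ)` of phase space. -/
def phasePoint {n : ℕ} (x ξ : Conf n) : Phase n :=
  WithLp.toLp 2 (Sum.elim x ξ)

/-- `L²(ℝⁿ)`, complex-valued, for Lebesgue measure. -/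
abbrev L2 (n : ℕ) : Type := Lp ℂ 2 (volume : Measure (Conf n))

/-- `𝓢(ℝⁿ)`, regarded as a subspace of `L²(ℝⁿ)`. -/
noncomputable def schwartzSubspace (n : ℕ) : Submodule ℂ (L2 n) :=
  LinearMap.range
    (SchwartzMap.toLpCLM ℂ ℂ 2 (volume : Measure (Conf n))).toLinearMap

/-- A real square matrix is hyperbolic if it has no complex eigenvalue on the unit circle. -/
def IsHyperbolic {ι : Type*} [Fintype ι] [DecidableEq ι] (M : Matrix ι ι ℝ) : Prop :=
  ∀ z : ℂ, Module.End.HasEigenvalue (Matrix.toLin' (M.map (algebraMap ℝ ℂ))) z → ‖z‖ ≠ 1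

/-- An invertible matrix `E` is expanding if `‖E⁻¹‖ < 1`, in the operator norm coming from the
Euclidean norm. -/
def IsExpanding {n : ℕ} (E : GL (Fin n) ℝ) : Prop :=
  ‖Matrix.toEuclideanCLM (𝕜 := ℝ) (E⁻¹ : GL (Fin n) ℝ).val‖ < 1

/-- The symbol class `S(1)`: smooth functions on phase space all of whose derivatives, of every
order `k ≥ 0`, are bounded. -/
def IsSymbol {n : ℕ} (a : Phase n → ℂ) : Prop :=
  ContDiff ℝ ∞ a ∧ ∀ k : ℕ, ∃ C : ℝ, ∀ z, ‖iteratedFDeriv ℝ k a z‖ ≤ C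

/-- The Weyl quantization formula
`(2πh)⁻ⁿ ∫∫ exp((i/h)⟨ξ, x - y⟩) a((x + y)/2, ξ) u(y) dy dξ`.
For `a ∈ S(1)` and `u` Schwartz the inner integral is a rapidly decreasing function of `ξ`, so that
the iterated integral converges absolutely; it is the value of the usual oscillatory integral. -/
noncomputable def weylFormula {n : ℕ} (h : ℝ) (a : Phase n → ℂ) (u : Conf n → ℂ)
    (x : Conf n) : ℂ :=
  ((((2 * Real.pi * h) ^ n)⁻¹ : ℝ) : ℂ) *
    ∫ ξ : Conf n, ∫ y : Conf n,
      Complex.exp (Complex.I / (h : ℂ) * ((inner ℝ ξ (x - y) : ℝ) : ℂ)) *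
        a (phasePoint ((2⁻¹ : ℝ) • (x + y)) ξ) * u y

/-- `A = Op_h(a)` as a bounded operator on `L²(ℝⁿ)`: the operator `A` is given on the (dense)
Schwartz space by the Weyl quantization formula. There is at most one such `A`. -/
def IsWeylOp {n : ℕ} (h : ℝ) (a : Phase n → ℂ) (A : L2 n →L[ℂ] L2 n) : Prop :=
  ∀ u : SchwartzMap (Conf n) ℂ,
    (A (u.toLp 2 volume) : Conf n → ℂ) =ᵐ[volume] weylFormula h a u

/-- `T` is a metaplectic operator `M_N` attached to the matrix `M`: a unitary operator on `L²(ℝⁿ)`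
such that, with `h = (2πN)⁻¹`, one has `T⁻¹ Op_h(a) T = Op_h(a ∘ M)` for all `a ∈ S(1)`. -/
def IsMetaplectic {n : ℕ} (N : ℕ) (M : Matrix (Fin n ⊕ Fin n) (Fin n ⊕ Fin n) ℝ)
    (T : L2 n ≃ₗᵢ[ℂ] L2 n) : Prop :=
  ∀ a : Phase n → ℂ, IsSymbol a → ∀ A B : L2 n →L[ℂ] L2 n,
    IsWeylOp (2 * Real.pi * N)⁻¹ a A →
    IsWeylOp (2 * Real.pi * N)⁻¹ (fun z => a (Matrix.toEuclideanCLM (𝕜 := ℝ) M z)) B →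
    ∀ f : L2 n, T.symm (A (T f)) = B f

/-- The action of the inverse matrix, `x ↦ E⁻¹ x`, on `ℝⁿ`. -/
noncomputable def invAct {n : ℕ} (E : GL (Fin n) ℝ) : Conf n →L[ℝ] Conf n :=
  Matrix.toEuclideanCLM (𝕜 := ℝ) (E⁻¹ : GL (Fin n) ℝ).val

theorem invAct_invAct {n : ℕ} (E : GL (Fin n) ℝ) (x : Conf n) :
    invAct E (invAct E⁻¹ x) = x := by
  have : invAct E * invAct E⁻¹ = 1 := by
    unfold invAct
    rw [← map_mul, ← Units.val_mul]
    simp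
  exact congrArg (fun L : Conf n →L[ℝ] Conf n => L x) this

theorem det_invAct {n : ℕ} (E : GL (Fin n) ℝ) :
    LinearMap.det (invAct E : Conf n →ₗ[ℝ] Conf n) = (E.val.det)⁻¹ := by
  have h1 : (invAct E : Conf n →ₗ[ℝ] Conf n) =
      Matrix.toLin (EuclideanSpace.basisFun (Fin n) ℝ).toBasis
        (EuclideanSpace.basisFun (Fin n) ℝ).toBasis (E⁻¹ : GL (Fin n) ℝ).val := by
    unfold invAct
    rw [Matrix.coe_toEuclideanCLM_eq_toEuclideanLin, Matrix.toEuclideanLin_eq_toLin_orthonormal]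
  rw [h1, LinearMap.det_toLin]
  simp

theorem det_val_ne_zero {n : ℕ} (E : GL (Fin n) ℝ) : E.val.det ≠ 0 :=
  ((Matrix.isUnit_iff_isUnit_det _).1 E.isUnit).ne_zero

theorem map_invAct {n : ℕ} (E : GL (Fin n) ℝ) :
    Measure.map (invAct E) (volume : Measure (Conf n)) =
      ENNReal.ofReal |E.val.det| • (volume : Measure (Conf n)) := by
  have h := Measure.map_linearMap_addHaar_eq_smul_addHaar (volume : Measure (Conf n))
    (f := (invAct E : Conf n →ₗ[ℝ] Conf n))
    (by rw [det_invAct]; exact inv_ne_zero (det_val_ne_zero E))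
  rw [det_invAct, inv_inv] at h
  exact h

theorem quasiMeasurePreserving_invAct {n : ℕ} (E : GL (Fin n) ℝ) :
    Measure.QuasiMeasurePreserving (invAct E) (volume : Measure (Conf n)) volume :=
  ⟨(invAct E).continuous.measurable, by
    rw [map_invAct]
    exact Measure.smul_absolutelyContinuous⟩

theorem eLpNorm_comp_invAct {n : ℕ} (E : GL (Fin n) ℝ) (u : L2 n) :
    eLpNorm (fun x => u (invAct E x)) 2 (volume : Measure (Conf n)) =
      ENNReal.ofReal |E.val.det| ^ (1 / 2 : ℝ) * eLpNorm u 2 volume := by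
  have h := eLpNorm_map_measure (μ := (volume : Measure (Conf n))) (f := invAct E) (g := u)
    (p := 2) ((Lp.aestronglyMeasurable u).mono_ac (quasiMeasurePreserving_invAct E).2)
    (invAct E).continuous.aemeasurable
  rw [map_invAct, eLpNorm_smul_measure_of_ne_top (by simp)] at h
  rw [show (fun x => u (invAct E x)) = u ∘ invAct E from rfl, ← h]
  simp

theorem memLp_comp_invAct {n : ℕ} (E : GL (Fin n) ℝ) (u : L2 n) :
    MemLp (fun x => u (invAct E x)) 2 (volume : Measure (Conf n)) := by
  refine ⟨(Lp.aestronglyMeasurable u).comp_quasiMeasurePreserving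
    (quasiMeasurePreserving_invAct E), ?_⟩
  rw [eLpNorm_comp_invAct]
  exact ENNReal.mul_lt_top (ENNReal.rpow_lt_top_of_nonneg (by norm_num) (by simp))
    (Lp.eLpNorm_lt_top u)

/-- The transfer operator `L_E u = u ∘ E⁻¹` on `L²(ℝⁿ)`. -/
noncomputable def transferOp {n : ℕ} (E : GL (Fin n) ℝ) : L2 n →ₗ[ℂ] L2 n where
  toFun u := (memLp_comp_invAct E u).toLp _
  map_add' u v := by
    rw [← MemLp.toLp_add]
    exact MemLp.toLp_congr _ _
      ((quasiMeasurePreserving_invAct E).ae_eq_comp (Lp.coeFn_add u v))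
  map_smul' c u := by
    rw [RingHom.id_apply, ← MemLp.toLp_const_smul]
    exact MemLp.toLp_congr _ _
      ((quasiMeasurePreserving_invAct E).ae_eq_comp (Lp.coeFn_smul c u))

theorem norm_transferOp {n : ℕ} (E : GL (Fin n) ℝ) (u : L2 n) :
    ‖transferOp E u‖ = |E.val.det| ^ (1 / 2 : ℝ) * ‖u‖ := by
  change ‖(memLp_comp_invAct E u).toLp _‖ = _
  rw [Lp.norm_toLp, eLpNorm_comp_invAct, ENNReal.toReal_mul, ← ENNReal.toReal_rpow,
    ENNReal.toReal_ofReal (abs_nonneg _), Lp.norm_def]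

theorem transferOp_transferOp {n : ℕ} (E : GL (Fin n) ℝ) (u : L2 n) :
    transferOp E⁻¹ (transferOp E u) = u := by
  apply Lp.ext
  refine (MemLp.coeFn_toLp (memLp_comp_invAct E⁻¹ (transferOp E u))).trans ?_
  refine ((quasiMeasurePreserving_invAct E⁻¹).ae_eq_comp
    (MemLp.coeFn_toLp (memLp_comp_invAct E u))).trans ?_
  refine Filter.Eventually.of_forall fun x => ?_
  simp [invAct_invAct]

/-- The unitary operator `|det E|^(-1/2) L_E` on `L²(ℝⁿ)`. -/
noncomputable def unitaryTransferOp {n : ℕ} (E : GL (Fin n) ℝ) : L2 n ≃ₗᵢ[ℂ] L2 n :=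
  LinearIsometryEquiv.ofSurjective
    { toLinearMap := ((|E.val.det| ^ (-(1 / 2) : ℝ) : ℝ) : ℂ) • transferOp E
      norm_map' := fun u => by
        have hd : 0 < |E.val.det| := abs_pos.2 (det_val_ne_zero E)
        rw [LinearMap.smul_apply, norm_smul, norm_transferOp, Complex.norm_real,
          Real.norm_of_nonneg (by positivity), ← mul_assoc, ← Real.rpow_add hd]
        norm_num }
    (fun v => by
      have hd : 0 < |E.val.det| := abs_pos.2 (det_val_ne_zero E)
      have hc : ((|E.val.det| ^ (-(1 / 2) : ℝ) : ℝ) : ℂ) ≠ 0 := by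
        exact_mod_cast (Real.rpow_pos_of_pos hd _).ne'
      refine ⟨(((|E.val.det| ^ (-(1 / 2) : ℝ) : ℝ) : ℂ))⁻¹ • transferOp E⁻¹ v, ?_⟩
      have h := transferOp_transferOp E⁻¹ v
      rw [inv_inv] at h
      change ((|E.val.det| ^ (-(1 / 2) : ℝ) : ℝ) : ℂ) • transferOp E _ = v
      rw [map_smul, h, smul_smul, mul_inv_cancel₀ hc, one_smul])

/-!
A metaplectic operator `T` attached to `M` conjugates the quantization of `e^{2πiN⟨w, z⟩}` into
that of `e^{2πiN⟨Mᵀw, z⟩}`. These quantizations are the Weyl–Heisenberg operators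
`u ↦ e^{2πiN(⟨p, x⟩ + ⟨p, q⟩ / 2)} u(x + q)`, `w = (p, q)` (`isWeylOp_heisenbergOp`), so `T`
implements the linear map `(Mᵀ)⁻¹` of `(p, q)`-space in the sense of `Intertwines`. This
determines `T` up to a phase, because the Weyl–Heisenberg operators act irreducibly
(`exists_smul_of_commutes_heisenbergOp`). Irreducibility comes from the fact that the matrix
coefficients of these operators are, for fixed `q`, Fourier transforms in `p` of
`x ↦ conj (f (x + q)) g x`.

The operator `|det E|^{-1/2} L_E` implements `(p, q) ↦ ((Eᵀ)⁻¹ p, E q)`. It therefore suffices to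
conjugate `(Mᵀ)⁻¹` to such a map, `E` expanding, by a linear map that is itself implemented by a
unitary operator preserving `𝓢(ℝⁿ)`. Multiplication by `e^{πiN⟨Bx, x⟩}` implements the shear
`(p - Bq, q)`, its conjugates by the Fourier transform implement the shears `(p, q + Cp)`, and
changes of variables implement the block diagonal maps. These generators suffice
(`exists_shears_of_isotropic`): the stable and the unstable subspace of a hyperbolic symplectic
map are isotropic and span, hence have dimension `n`; a shear `(p + tq, q)` makes the stable
subspace a graph `q = Bp` with `B` symmetric, a second shear carries it to `q = 0`, and a third
one carries the unstable subspace to `p = 0`. The inverse of the expanding block is then a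
contraction for a suitable Euclidean norm (`exists_conj_norm_lt_one`), which is made standard by a
block diagonal map.

This gives the equivalence of `cT` with `|det E|^{-1/2} L_E` for some phase `c`. The phase is
removed at the cost of smoothness: multiplication by `φ` turns `|det E|^{-1/2} L_E` into
`c |det E|^{-1/2} L_E` when `φ(x) = c φ(E⁻¹x)`, and `φ = c^k` has this property when `k(x)` is the
least integer with `‖E^{-k} x‖ < 1` (`exists_unitary_conj_smul`).
-/

open scoped FourierTransform SchwartzMap
open Filter Topology

/-! ### Weyl–Heisenberg operators and implementation of linear maps -/

theorem memLp_unimodular_mul {n : ℕ} (φ : Conf n → Circle)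
    (hφ : Measurable fun x => (φ x : ℂ)) (u : L2 n) :
    MemLp (fun x => (φ x : ℂ) * u x) 2 volume :=
  (Lp.memLp u).of_le (hφ.aestronglyMeasurable.mul (Lp.aestronglyMeasurable u))
    (Filter.Eventually.of_forall fun x => by rw [norm_mul, Circle.norm_coe, one_mul])

/-- Multiplication by a measurable function with values in the unit circle, as a unitary operator
on `L²(ℝⁿ)`. Measurability is that of the underlying complex-valued function. -/
noncomputable def unimodularMul {n : ℕ} (φ : Conf n → Circle)
    (hφ : Measurable fun x => (φ x : ℂ)) : L2 n ≃ₗᵢ[ℂ] L2 n :=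
  have hinv : Measurable fun x => (((φ x)⁻¹ : Circle) : ℂ) := by
    simp only [Circle.coe_inv]
    exact hφ.inv
  LinearIsometryEquiv.ofSurjective
    { toFun := fun u => (memLp_unimodular_mul φ hφ u).toLp _
      map_add' := fun u v => by
        rw [← MemLp.toLp_add]
        refine MemLp.toLp_congr _ _ ?_
        filter_upwards [Lp.coeFn_add u v] with x hx
        simp only [hx, Pi.add_apply, mul_add]
      map_smul' := fun c u => by
        rw [RingHom.id_apply, ← MemLp.toLp_const_smul]
        refine MemLp.toLp_congr _ _ ?_
        filter_upwards [Lp.coeFn_smul c u] with x hx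
        simp only [hx, Pi.smul_apply, smul_eq_mul, mul_left_comm]
      norm_map' := fun u => by
        change ‖(memLp_unimodular_mul φ hφ u).toLp _‖ = _
        rw [Lp.norm_toLp, Lp.norm_def]
        congr 1
        exact eLpNorm_congr_norm_ae (Filter.Eventually.of_forall fun x => by
          rw [norm_mul, Circle.norm_coe, one_mul]) }
    (fun v => by
      refine ⟨(memLp_unimodular_mul (fun x => (φ x)⁻¹) hinv v).toLp _, Lp.ext ?_⟩
      refine (MemLp.coeFn_toLp (memLp_unimodular_mul φ hφ _)).trans ?_
      filter_upwards [MemLp.coeFn_toLp (memLp_unimodular_mul (fun x => (φ x)⁻¹) hinv v)] with x hx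
      rw [hx, ← mul_assoc, ← Circle.coe_mul, mul_inv_cancel, Circle.coe_one, one_mul])

theorem coeFn_unimodularMul {n : ℕ} (φ : Conf n → Circle) (hφ : Measurable fun x => (φ x : ℂ))
    (u : L2 n) : unimodularMul φ hφ u =ᵐ[volume] fun x => (φ x : ℂ) * u x :=
  MemLp.coeFn_toLp (memLp_unimodular_mul φ hφ u)

theorem coeFn_unimodularMul_symm {n : ℕ} (φ : Conf n → Circle)
    (hφ : Measurable fun x => (φ x : ℂ)) (u : L2 n) :
    (unimodularMul φ hφ).symm u =ᵐ[volume] fun x => (((φ x)⁻¹ : Circle) : ℂ) * u x := by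
  have h := coeFn_unimodularMul φ hφ ((unimodularMul φ hφ).symm u)
  rw [LinearIsometryEquiv.apply_symm_apply] at h
  filter_upwards [h] with x hx
  rw [hx, ← mul_assoc, ← Circle.coe_mul, inv_mul_cancel, Circle.coe_one, one_mul]

/-- The translation `u ↦ u(· + q)` on `L²(ℝⁿ)`. -/
noncomputable def translationOp {n : ℕ} (q : Conf n) : L2 n →ₗᵢ[ℂ] L2 n :=
  Lp.compMeasurePreservingₗᵢ ℂ (fun x => x + q) (measurePreserving_add_right volume q)

theorem coeFn_translationOp {n : ℕ} (q : Conf n) (u : L2 n) :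
    translationOp q u =ᵐ[volume] fun x => u (x + q) :=
  Lp.coeFn_compMeasurePreserving u (measurePreserving_add_right volume q)

/-- The phase `e^{2πiκ(⟨p, x⟩ + ⟨p, q⟩ / 2)}`. -/
noncomputable def weylPhase {n : ℕ} (κ : ℝ) (ζ : Conf n × Conf n) (x : Conf n) : Circle :=
  Real.fourierChar (κ * (inner ℝ ζ.1 x + inner ℝ ζ.1 ζ.2 / 2))

theorem measurable_weylPhase {n : ℕ} (κ : ℝ) (ζ : Conf n × Conf n) :
    Measurable fun x => (weylPhase κ ζ x : ℂ) := by
  unfold weylPhase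
  exact (continuous_subtype_val.comp (Real.continuous_fourierChar.comp (by fun_prop))).measurable

/-- The Weyl–Heisenberg operator `u ↦ e^{2πiκ(⟨p, x⟩ + ⟨p, q⟩ / 2)} u(x + q)`, `ζ = (p, q)`. For
`κ = (2πh)⁻¹` it is the Weyl quantization of `e^{2πiκ(⟨p, x⟩ + ⟨q, ξ⟩)}`. -/
noncomputable def heisenbergOp {n : ℕ} (κ : ℝ) (ζ : Conf n × Conf n) : L2 n →ₗᵢ[ℂ] L2 n :=
  (unimodularMul (weylPhase κ ζ) (measurable_weylPhase κ ζ)).toLinearIsometry.comp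
    (translationOp ζ.2)

theorem coeFn_heisenbergOp {n : ℕ} (κ : ℝ) (ζ : Conf n × Conf n) (u : L2 n) :
    heisenbergOp κ ζ u =ᵐ[volume] fun x => (weylPhase κ ζ x : ℂ) * u (x + ζ.2) := by
  refine (coeFn_unimodularMul _ (measurable_weylPhase κ ζ) _).trans ?_
  filter_upwards [coeFn_translationOp ζ.2 u] with x hx
  exact congrArg _ hx

/-- `T` implements the linear map `S` of `(p, q)`-space: conjugation by `T` takes the
Weyl–Heisenberg operator of `ζ` to that of `S ζ`. -/
def Intertwines {n : ℕ} (κ : ℝ) (S : (Conf n × Conf n) ≃ₗ[ℝ] (Conf n × Conf n))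
    (T : L2 n ≃ₗᵢ[ℂ] L2 n) : Prop :=
  ∀ ζ f, T (heisenbergOp κ ζ f) = heisenbergOp κ (S ζ) (T f)

namespace Intertwines
variable {n : ℕ} {κ : ℝ} {S S' : (Conf n × Conf n) ≃ₗ[ℝ] (Conf n × Conf n)}
  {T T' : L2 n ≃ₗᵢ[ℂ] L2 n}

theorem trans (h : Intertwines κ S T) (h' : Intertwines κ S' T') :
    Intertwines κ (S.trans S') (T.trans T') := fun ζ f => by
  simp [h ζ f, h' (S ζ) (T f)]

theorem symm (h : Intertwines κ S T) : Intertwines κ S.symm T.symm := fun ζ f => by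
  rw [LinearIsometryEquiv.symm_apply_eq, h]
  simp

end Intertwines

/-- `T` maps `𝓢(ℝⁿ)` onto itself. -/
def PreservesSchwartz {n : ℕ} (T : L2 n ≃ₗᵢ[ℂ] L2 n) : Prop :=
  (schwartzSubspace n).map T.toLinearEquiv.toLinearMap = schwartzSubspace n

namespace PreservesSchwartz
variable {n : ℕ} {T T' : L2 n ≃ₗᵢ[ℂ] L2 n}

theorem of_mapsTo (h : ∀ u : 𝓢(Conf n, ℂ), T (u.toLp 2 volume) ∈ schwartzSubspace n)
    (h' : ∀ u : 𝓢(Conf n, ℂ), T.symm (u.toLp 2 volume) ∈ schwartzSubspace n) :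
    PreservesSchwartz T := by
  refine le_antisymm ?_ ?_
  · rintro _ ⟨_, ⟨u, rfl⟩, rfl⟩
    exact h u
  · rintro _ ⟨u, rfl⟩
    exact ⟨_, h' u, T.apply_symm_apply _⟩

theorem trans (h : PreservesSchwartz T) (h' : PreservesSchwartz T') :
    PreservesSchwartz (T.trans T') := by
  have : (schwartzSubspace n).map (T.trans T').toLinearEquiv.toLinearMap =
      ((schwartzSubspace n).map T.toLinearEquiv.toLinearMap).map T'.toLinearEquiv.toLinearMap :=
    Submodule.map_comp _ _ _
  rw [PreservesSchwartz, this, h, h']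

theorem symm (h : PreservesSchwartz T) : PreservesSchwartz T.symm := by
  unfold PreservesSchwartz at *
  nth_rw 1 [← h]
  rw [← Submodule.map_comp]
  convert! Submodule.map_id _
  ext1 f
  exact T.symm_apply_apply f

end PreservesSchwartz

/-- The linear map `S` is implemented by a unitary operator that preserves the Schwartz space. -/
def IsImplementable {n : ℕ} (κ : ℝ) (S : (Conf n × Conf n) ≃ₗ[ℝ] (Conf n × Conf n)) : Prop :=
  ∃ T : L2 n ≃ₗᵢ[ℂ] L2 n, Intertwines κ S T ∧ PreservesSchwartz T

namespace IsImplementable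
variable {n : ℕ} {κ : ℝ} {S S' : (Conf n × Conf n) ≃ₗ[ℝ] (Conf n × Conf n)}

theorem trans (h : IsImplementable κ S) (h' : IsImplementable κ S') :
    IsImplementable κ (S.trans S') :=
  let ⟨T, h1, h2⟩ := h
  let ⟨T', h1', h2'⟩ := h'
  ⟨T.trans T', h1.trans h1', h2.trans h2'⟩

theorem symm (h : IsImplementable κ S) : IsImplementable κ S.symm :=
  let ⟨T, h1, h2⟩ := h
  ⟨T.symm, h1.symm, h2.symm⟩

end IsImplementable

/-! ### Generators: chirps, the Fourier transform, changes of variables -/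

/-- The shear `(p, q) ↦ (p - Bq, q)`. -/
def lowerShear {n : ℕ} (B : Conf n →ₗ[ℝ] Conf n) :
    (Conf n × Conf n) ≃ₗ[ℝ] (Conf n × Conf n) where
  toFun ζ := (ζ.1 - B ζ.2, ζ.2)
  invFun ζ := (ζ.1 + B ζ.2, ζ.2)
  map_add' ζ η := by ext1 <;> simp; abel
  map_smul' c ζ := by ext1 <;> simp [smul_sub]
  left_inv ζ := by simp
  right_inv ζ := by simp

/-- The map `(p, q) ↦ (κ⁻¹ q, -κ p)` induced by the Fourier transform. -/
noncomputable def scaledRotation (n : ℕ) {κ : ℝ} (hκ : κ ≠ 0) :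
    (Conf n × Conf n) ≃ₗ[ℝ] (Conf n × Conf n) where
  toFun ζ := (κ⁻¹ • ζ.2, -(κ • ζ.1))
  invFun ζ := (-(κ⁻¹ • ζ.2), κ • ζ.1)
  map_add' ζ η := by ext1 <;> simp; abel
  map_smul' c ζ := by ext1 <;> simp [smul_comm c]
  left_inv ζ := by ext1 <;> simp [smul_smul, hκ]
  right_inv ζ := by ext1 <;> simp [smul_smul, hκ]

/-- The shear `(p, q) ↦ (p, q + Cp)`. -/
def upperShear {n : ℕ} (C : Conf n →ₗ[ℝ] Conf n) :
    (Conf n × Conf n) ≃ₗ[ℝ] (Conf n × Conf n) where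
  toFun ζ := (ζ.1, ζ.2 + C ζ.1)
  invFun ζ := (ζ.1, ζ.2 - C ζ.1)
  map_add' ζ η := by ext1 <;> simp; abel
  map_smul' c ζ := by ext1 <;> simp
  left_inv ζ := by simp
  right_inv ζ := by simp

/-- The quadratic phase `e^{πi⟨Bx, x⟩}`. -/
noncomputable def chirp {n : ℕ} (B : Conf n →ₗ[ℝ] Conf n) (x : Conf n) : Circle :=
  Real.fourierChar (inner ℝ (B x) x / 2)

theorem fourierChar_eq_cexp (t : ℝ) :
    (Real.fourierChar t : ℂ) = Complex.exp ((2 * Real.pi * Complex.I) * t) := by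
  rw [Real.fourierChar_apply]
  congr 1
  push_cast
  ring

theorem contDiff_fourierChar : ContDiff ℝ ∞ fun t : ℝ => (Real.fourierChar t : ℂ) := by
  simp_rw [fourierChar_eq_cexp]
  exact Complex.contDiff_exp.comp (contDiff_const.mul Complex.ofRealCLM.contDiff)

theorem iteratedDeriv_fourierChar (k : ℕ) :
    iteratedDeriv k (fun t : ℝ => (Real.fourierChar t : ℂ)) =
      fun t => (2 * Real.pi * Complex.I) ^ k * Real.fourierChar t := by
  simp_rw [fourierChar_eq_cexp]
  induction k with
  | zero => simp
  | succ k ih =>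
    rw [iteratedDeriv_succ, ih]
    ext t
    have h : HasDerivAt (fun t : ℝ => Complex.exp ((2 * Real.pi * Complex.I) * t))
        (Complex.exp ((2 * Real.pi * Complex.I) * t) * ((2 * Real.pi * Complex.I) * 1)) t :=
      (Complex.ofRealCLM.hasDerivAt.const_mul _).cexp
    rw [(h.const_mul _).deriv]
    ring

theorem norm_iteratedFDeriv_fourierChar (k : ℕ) (t : ℝ) :
    ‖iteratedFDeriv ℝ k (fun t : ℝ => (Real.fourierChar t : ℂ)) t‖ = (2 * Real.pi) ^ k := by
  rw [norm_iteratedFDeriv_eq_norm_iteratedDeriv, iteratedDeriv_fourierChar]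
  rw [norm_mul, Circle.norm_coe]
  simp [abs_of_pos Real.pi_pos]

theorem hasTemperateGrowth_fourierChar :
    Function.HasTemperateGrowth fun t : ℝ => (Real.fourierChar t : ℂ) :=
  ⟨contDiff_fourierChar, fun k => ⟨0, (2 * Real.pi) ^ k, fun t => by
    simp [norm_iteratedFDeriv_fourierChar]⟩⟩

theorem hasTemperateGrowth_inner_apply_self {n : ℕ} (B : Conf n →ₗ[ℝ] Conf n) :
    Function.HasTemperateGrowth fun x => inner ℝ (B x) x :=
  (innerSL ℝ).bilinear_hasTemperateGrowth (LinearMap.toContinuousLinearMap B).hasTemperateGrowth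
    .id'

theorem hasTemperateGrowth_chirp {n : ℕ} (B : Conf n →ₗ[ℝ] Conf n) :
    Function.HasTemperateGrowth fun x => (chirp B x : ℂ) := by
  have h := (hasTemperateGrowth_inner_apply_self B).mul (.const (2⁻¹ : ℝ))
  exact hasTemperateGrowth_fourierChar.comp h

theorem chirp_neg {n : ℕ} (B : Conf n →ₗ[ℝ] Conf n) (x : Conf n) :
    chirp (-B) x = (chirp B x)⁻¹ := by
  rw [chirp, chirp, ← AddChar.map_neg_eq_inv]
  simp [neg_div]

theorem measurable_chirp {n : ℕ} (B : Conf n →ₗ[ℝ] Conf n) :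
    Measurable fun x => (chirp B x : ℂ) :=
  (hasTemperateGrowth_chirp B).1.continuous.measurable

/-- Conjugation by multiplication by `e^{πiκ⟨Bx, x⟩}`. -/
theorem isImplementable_lowerShear {n : ℕ} (κ : ℝ) (B : Conf n →ₗ[ℝ] Conf n)
    (hB : B.IsSymmetric) : IsImplementable κ (lowerShear B) := by
  refine ⟨unimodularMul (chirp (κ • B)) (measurable_chirp _), fun ζ f => Lp.ext ?_,
    .of_mapsTo (fun u => ⟨SchwartzMap.smulLeftCLM ℂ (fun x => (chirp (κ • B) x : ℂ)) u, Lp.ext ?_⟩)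
      fun u => ⟨SchwartzMap.smulLeftCLM ℂ (fun x => (chirp (-(κ • B)) x : ℂ)) u, Lp.ext ?_⟩⟩
  · refine (coeFn_unimodularMul _ (measurable_chirp _) _).trans ?_
    refine .trans ?_ (coeFn_heisenbergOp _ _ _).symm
    filter_upwards [coeFn_heisenbergOp κ ζ f, (measurePreserving_add_right volume
      ζ.2).quasiMeasurePreserving.ae (coeFn_unimodularMul (chirp (κ • B)) (measurable_chirp _) f)]
      with x hx hx'
    change _ = _ * (unimodularMul (chirp (κ • B)) (measurable_chirp _) f) (x + ζ.2)
    rw [hx, hx', ← mul_assoc, ← mul_assoc, ← Circle.coe_mul, ← Circle.coe_mul]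
    congr 2
    simp only [weylPhase, chirp, lowerShear, ← AddChar.map_add_eq_mul]
    congr 1
    have h1 : inner ℝ (B ζ.2) x = inner ℝ (B x) ζ.2 := by
      rw [hB, real_inner_comm]
    simp [inner_add_left, inner_add_right, inner_sub_left, inner_smul_left, h1]
    ring
  · refine (SchwartzMap.coeFn_toLp _ _ _).trans ?_
    refine .trans ?_ (coeFn_unimodularMul _ (measurable_chirp _) _).symm
    filter_upwards [u.coeFn_toLp 2 volume] with x hx
    rw [hx]
    exact SchwartzMap.smulLeftCLM_apply_apply (hasTemperateGrowth_chirp _) u x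
  · refine (SchwartzMap.coeFn_toLp _ _ _).trans ?_
    refine .trans ?_ (coeFn_unimodularMul_symm _ (measurable_chirp _) _).symm
    filter_upwards [u.coeFn_toLp 2 volume] with x hx
    rw [hx, ← chirp_neg]
    exact SchwartzMap.smulLeftCLM_apply_apply (hasTemperateGrowth_chirp _) u x

theorem fourier_weylPhase_mul {n : ℕ} {κ : ℝ} (hκ : κ ≠ 0) (ζ : Conf n × Conf n)
    (u : Conf n → ℂ) (η : Conf n) :
    𝓕 (fun x => (weylPhase κ ζ x : ℂ) * u (x + ζ.2)) η =
      weylPhase κ (scaledRotation n hκ ζ) η * 𝓕 u (η + (scaledRotation n hκ ζ).2) := by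
  rw [Real.fourier_eq, Real.fourier_eq, ← integral_const_mul]
  refine Eq.trans ?_ (integral_add_right_eq_self _ ζ.2)
  refine integral_congr_ae (Filter.Eventually.of_forall fun x => ?_)
  simp only [Circle.smul_def, smul_eq_mul]
  rw [← mul_assoc, ← mul_assoc, ← Circle.coe_mul, ← Circle.coe_mul]
  congr 2
  simp only [weylPhase, scaledRotation, ← AddChar.map_add_eq_mul]
  congr 1
  simp [inner_add_left, inner_add_right, inner_smul_left, inner_smul_right, real_inner_comm]
  field_simp
  ring

theorem exists_schwartzMap_heisenbergOp {n : ℕ} (κ : ℝ) (ζ : Conf n × Conf n)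
    (u : 𝓢(Conf n, ℂ)) : ∃ v : 𝓢(Conf n, ℂ),
      (∀ x, v x = weylPhase κ ζ x * u (x + ζ.2)) ∧
        heisenbergOp κ ζ (u.toLp 2 volume) = v.toLp 2 volume := by
  have hg : Function.HasTemperateGrowth fun x : Conf n => x + ζ.2 := .add .id' (.const _)
  have hw : Function.HasTemperateGrowth fun x => (weylPhase κ ζ x : ℂ) :=
    hasTemperateGrowth_fourierChar.comp <| (Function.HasTemperateGrowth.const κ).mul <|
      (Function.hasTemperateGrowth_inner_right ζ.1).add (.const _)
  have hv : ∀ x, SchwartzMap.smulLeftCLM ℂ (fun x => (weylPhase κ ζ x : ℂ))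
      (SchwartzMap.compCLMOfAntilipschitz ℂ hg (isometry_add_right ζ.2).antilipschitz u) x =
        weylPhase κ ζ x * u (x + ζ.2) := fun x => SchwartzMap.smulLeftCLM_apply_apply hw _ x
  refine ⟨_, hv, Lp.ext ?_⟩
  refine (coeFn_heisenbergOp _ _ _).trans ?_
  refine .trans ?_ (SchwartzMap.coeFn_toLp _ _ _).symm
  filter_upwards [(measurePreserving_add_right volume ζ.2).quasiMeasurePreserving.ae
    (u.coeFn_toLp 2 volume)] with x hx
  rw [hv, hx]

theorem isImplementable_scaledRotation (n : ℕ) {κ : ℝ} (hκ : κ ≠ 0) :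
    IsImplementable κ (scaledRotation n hκ) := by
  have hF : ∀ u : 𝓢(Conf n, ℂ), Lp.fourierTransformₗᵢ (Conf n) ℂ (u.toLp 2 volume) =
    (𝓕 u).toLp 2 volume := SchwartzMap.toLp_fourier_eq
  refine ⟨Lp.fourierTransformₗᵢ (Conf n) ℂ, fun ζ f => ?_,
    .of_mapsTo (fun u => ⟨𝓕 u, ?_⟩) fun u => ⟨𝓕⁻ u, ?_⟩⟩
  · refine DenseRange.induction_on (SchwartzMap.denseRange_toLpCLM (E := Conf n) (F := ℂ) (p := 2)
      (μ := volume) ENNReal.ofNat_ne_top) f (isClosed_eq (by fun_prop) (by fun_prop)) fun u => ?_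
    obtain ⟨v, hv, hv'⟩ := exists_schwartzMap_heisenbergOp κ ζ u
    rw [SchwartzMap.toLpCLM_apply, hv', hF, hF]
    refine Lp.ext (.trans ?_ (coeFn_heisenbergOp _ _ _).symm)
    filter_upwards [(𝓕 v).coeFn_toLp 2 volume,
      (measurePreserving_add_right volume (scaledRotation n hκ ζ).2).quasiMeasurePreserving.ae
        ((𝓕 u).coeFn_toLp 2 volume)] with η h1 h2
    rw [h1, h2, SchwartzMap.fourier_coe, SchwartzMap.fourier_coe, ← fourier_weylPhase_mul,
      funext hv]
  · exact (SchwartzMap.toLp_fourier_eq u).symm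
  · exact (SchwartzMap.toLp_fourierInv_eq u).symm

/-- An upper shear is a lower shear conjugated by the Fourier transform. -/
theorem isImplementable_upperShear {n : ℕ} {κ : ℝ} (hκ : κ ≠ 0) (C : Conf n →ₗ[ℝ] Conf n)
    (hC : C.IsSymmetric) : IsImplementable κ (upperShear C) := by
  have h := ((isImplementable_scaledRotation n hκ).trans (isImplementable_lowerShear κ
    ((κ⁻¹ ^ 2) • C) (hC.smul (by simp)))).trans (isImplementable_scaledRotation n hκ).symm
  convert h using 1
  ext ζ <;> simp [upperShear, scaledRotation, lowerShear, smul_smul] <;> field_simp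

/-- The linear action of `E` on `ℝⁿ`; its inverse is `invAct E`. -/
noncomputable def actEquiv {n : ℕ} (E : GL (Fin n) ℝ) : Conf n ≃L[ℝ] Conf n :=
  .equivOfInverse (invAct E⁻¹) (invAct E)
    (fun x => invAct_invAct E x) fun x => by simpa using invAct_invAct E⁻¹ x

/-- The map `(p, q) ↦ ((Eᵀ)⁻¹ p, E q)`. -/
noncomputable def diagonalMap {n : ℕ} (E : GL (Fin n) ℝ) :
    (Conf n × Conf n) ≃ₗ[ℝ] (Conf n × Conf n) where
  toFun ζ := (ContinuousLinearMap.adjoint (invAct E) ζ.1, invAct E⁻¹ ζ.2)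
  invFun ζ := (ContinuousLinearMap.adjoint (invAct E⁻¹) ζ.1, invAct E ζ.2)
  map_add' ζ η := by simp
  map_smul' c ζ := by simp
  left_inv ζ := by
    ext1
    · refine ext_inner_right ℝ fun x => ?_
      simp [ContinuousLinearMap.adjoint_inner_left, invAct_invAct]
    · simp [invAct_invAct]
  right_inv ζ := by
    ext1
    · refine ext_inner_right ℝ fun x => ?_
      have := invAct_invAct E⁻¹ x
      rw [inv_inv] at this
      simp [ContinuousLinearMap.adjoint_inner_left, this]
    · have := invAct_invAct E⁻¹ ζ.2
      rw [inv_inv] at this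
      simp [this]

theorem coeFn_unitaryTransferOp {n : ℕ} (E : GL (Fin n) ℝ) (u : L2 n) :
    unitaryTransferOp E u =ᵐ[volume]
      fun x => ((|E.val.det| ^ (-(1 / 2) : ℝ) : ℝ) : ℂ) * u (invAct E x) := by
  refine (Lp.coeFn_smul ((|E.val.det| ^ (-(1 / 2) : ℝ) : ℝ) : ℂ) (transferOp E u)).trans ?_
  filter_upwards [MemLp.coeFn_toLp (memLp_comp_invAct E u)] with x hx
  exact congrArg (fun z : ℂ => ((|E.val.det| ^ (-(1 / 2) : ℝ) : ℝ) : ℂ) * z) hx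

theorem intertwines_unitaryTransferOp {n : ℕ} (κ : ℝ) (E : GL (Fin n) ℝ) :
    Intertwines κ (diagonalMap E) (unitaryTransferOp E) := fun ζ f => Lp.ext <| by
  refine (coeFn_unitaryTransferOp E _).trans ?_
  refine .trans ?_ (coeFn_heisenbergOp _ _ _).symm
  filter_upwards [(quasiMeasurePreserving_invAct E).ae (coeFn_heisenbergOp κ ζ f),
    (measurePreserving_add_right volume (diagonalMap E ζ).2).quasiMeasurePreserving.ae
      (coeFn_unitaryTransferOp E f)] with x h1 h2
  rw [h1, h2]
  have h3 : weylPhase κ (diagonalMap E ζ) x = weylPhase κ ζ (invAct E x) := by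
    simp [weylPhase, diagonalMap, ContinuousLinearMap.adjoint_inner_left, invAct_invAct]
  rw [h3]
  simp only [diagonalMap, LinearEquiv.coe_mk, LinearMap.coe_mk, AddHom.coe_mk, map_add,
    invAct_invAct]
  ring

theorem preservesSchwartz_unitaryTransferOp {n : ℕ} (E : GL (Fin n) ℝ) :
    PreservesSchwartz (unitaryTransferOp E) := by
  refine .of_mapsTo (fun u => ⟨((|E.val.det| ^ (-(1 / 2) : ℝ) : ℝ) : ℂ) •
    SchwartzMap.compCLMOfContinuousLinearEquiv ℂ (actEquiv E).symm u, Lp.ext ?_⟩)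
    fun u => ⟨(((|E.val.det| ^ (-(1 / 2) : ℝ) : ℝ) : ℂ))⁻¹ •
    SchwartzMap.compCLMOfContinuousLinearEquiv ℂ (actEquiv E) u, ?_⟩
  · refine (SchwartzMap.coeFn_toLp _ _ _).trans (.trans ?_ (coeFn_unitaryTransferOp E _).symm)
    filter_upwards [(quasiMeasurePreserving_invAct E).ae (u.coeFn_toLp 2 volume)] with x hx
    rw [hx]
    rfl
  · refine ((LinearIsometryEquiv.symm_apply_eq _).2 (Lp.ext ?_)).symm
    refine (SchwartzMap.coeFn_toLp _ _ _).trans (.trans ?_ (coeFn_unitaryTransferOp E _).symm)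
    filter_upwards [(quasiMeasurePreserving_invAct E).ae
      (SchwartzMap.coeFn_toLp ((((|E.val.det| ^ (-(1 / 2) : ℝ) : ℝ) : ℂ))⁻¹ •
        SchwartzMap.compCLMOfContinuousLinearEquiv ℂ (actEquiv E) u) 2 volume)] with x hx
    have hc : ((|E.val.det| ^ (-(1 / 2) : ℝ) : ℝ) : ℂ) ≠ 0 := by
      exact_mod_cast (Real.rpow_pos_of_pos (abs_pos.2 (det_val_ne_zero E)) _).ne'
    have h1 : actEquiv E (invAct E x) = x := (actEquiv E).apply_symm_apply x
    refine Eq.trans ?_ (congrArg _ hx.symm)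
    simp only [smul_apply, SchwartzMap.compCLMOfContinuousLinearEquiv_apply,
      Function.comp_apply, h1, smul_eq_mul]
    rw [← mul_assoc, mul_inv_cancel₀ hc, one_mul]

theorem isImplementable_diagonalMap {n : ℕ} (κ : ℝ) (E : GL (Fin n) ℝ) :
    IsImplementable κ (diagonalMap E) :=
  ⟨_, intertwines_unitaryTransferOp κ E, preservesSchwartz_unitaryTransferOp E⟩

/-! ### Irreducibility and the Weyl quantization of exponentials -/

/-- Injectivity of the Fourier transform on `L¹`. -/
theorem ae_eq_of_fourier_eq {n : ℕ} {f g : Conf n → ℂ} (hf : Integrable f) (hg : Integrable g)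
    (h : 𝓕 f = 𝓕 g) : f =ᵐ[volume] g := by
  have key : ∀ (u : 𝓢(Conf n, ℂ)) (k : Conf n → ℂ), Integrable k →
      ∫ x, u x • k x = ∫ x, (𝓕⁻ u) x • 𝓕 k x := fun u k hk => by
    have := VectorFourier.integral_fourierIntegral_smul_eq_flip (L := innerₗ (Conf n))
      Real.continuous_fourierChar continuous_inner ((𝓕⁻ u).integrable (μ := volume)) hk
    rw [flip_innerₗ] at this
    have h1 : ⇑u = 𝓕 ⇑(𝓕⁻ u : 𝓢(Conf n, ℂ)) := by
      rw [← SchwartzMap.fourier_coe, FourierTransform.fourier_fourierInv_eq]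
    rw [h1]
    exact this
  refine ae_eq_of_integral_contDiff_smul_eq hf.locallyIntegrable hg.locallyIntegrable
    fun φ hφ hφ' => ?_
  have hc : HasCompactSupport fun x => (φ x : ℂ) := hφ'.comp_left (g := Complex.ofReal) rfl
  have hs : ContDiff ℝ ∞ fun x => (φ x : ℂ) := Complex.ofRealCLM.contDiff.comp hφ
  have h1 := key (hc.toSchwartzMap hs) f hf
  rw [h, ← key _ g hg] at h1
  simpa using h1

theorem inner_heisenbergOp {n : ℕ} (κ : ℝ) (p q : Conf n) (f g : L2 n) :
    inner ℂ (heisenbergOp κ (p, q) f) g =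
      Real.fourierChar (-(κ * (inner ℝ p q / 2))) *
        𝓕 (fun x => inner ℂ (f (x + q)) (g x)) (κ • p) := by
  rw [L2.inner_def, Real.fourier_eq, ← integral_const_mul]
  refine integral_congr_ae ?_
  filter_upwards [coeFn_heisenbergOp κ (p, q) f] with x hx
  simp only [hx, Circle.smul_def, smul_eq_mul]
  rw [← smul_eq_mul (weylPhase _ _ _ : ℂ), inner_smul_left, weylPhase, Circle.starRingEnd_addChar,
    ← mul_assoc, ← Circle.coe_mul, ← AddChar.map_add_eq_mul]
  congr 4
  rw [inner_smul_right, real_inner_comm p x]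
  ring

/-- The matrix coefficients of the Weyl–Heisenberg operators determine the function
`(x, y) ↦ conj (f y) g x`: for fixed `q` they are, as functions of `p`, the Fourier transform of
`x ↦ conj (f (x + q)) g x`. -/
theorem ae_ae_eq_of_inner_heisenbergOp_eq {n : ℕ} {κ : ℝ} (hκ : κ ≠ 0) {f g f' g' : L2 n}
    (h : ∀ ζ, inner ℂ (heisenbergOp κ ζ f) g = inner ℂ (heisenbergOp κ ζ f') g') :
    ∀ᵐ x, ∀ᵐ y, inner ℂ (f y) (g x) = inner ℂ (f' y) (g' x) := by
  have hint : ∀ (f g : L2 n) (q : Conf n), Integrable fun x => inner ℂ (f (x + q)) (g x) :=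
    fun f g q => (L2.integrable_inner (𝕜 := ℂ) (translationOp q f) g).congr <| by
      filter_upwards [coeFn_translationOp q f] with x hx
      rw [hx]
  -- The substitution `y = x + q` requires an exchange of the two null sets.
  have h1 : ∀ᵐ q, ∀ᵐ x, inner ℂ (f (x + q)) (g x) = inner ℂ (f' (x + q)) (g' x) := by
    refine Filter.Eventually.of_forall fun q => ae_eq_of_fourier_eq (hint f g q) (hint f' g' q) ?_
    ext η
    have h2 := h (κ⁻¹ • η, q)
    rwa [inner_heisenbergOp, inner_heisenbergOp, mul_right_inj' (Circle.coe_ne_zero _),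
      smul_smul, mul_inv_cancel₀ hκ, one_smul] at h2
  have hm : ∀ f g : L2 n, Measurable fun z : Conf n × Conf n => inner ℂ (f (z.2 + z.1)) (g z.2) :=
    fun f g => ((Lp.stronglyMeasurable f).measurable.comp
      (measurable_snd.add measurable_fst)).inner
        ((Lp.stronglyMeasurable g).measurable.comp measurable_snd)
  rw [Measure.ae_ae_comm (p := fun q x : Conf n =>
    inner ℂ (f (x + q)) (g x) = inner ℂ (f' (x + q)) (g' x))
    (measurableSet_eq_fun (hm f g) (hm f' g'))] at h1
  filter_upwards [h1] with x hx
  have h2 := (measurePreserving_add_left volume (-x)).quasiMeasurePreserving.ae hx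
  simpa using h2

/-- Schur's lemma for the Weyl–Heisenberg operators: a unitary operator that commutes with all of
them is a scalar. -/
theorem exists_smul_of_commutes_heisenbergOp {n : ℕ} {κ : ℝ} (hκ : κ ≠ 0) (T : L2 n ≃ₗᵢ[ℂ] L2 n)
    (hT : ∀ ζ f, T (heisenbergOp κ ζ f) = heisenbergOp κ ζ (T f)) :
    ∃ c : ℂ, ‖c‖ = 1 ∧ ∀ f, T f = c • f := by
  by_cases h0 : ∃ f : L2 n, f ≠ 0
  · obtain ⟨f, hf⟩ := h0
    have hff : inner ℂ f f ≠ 0 := inner_self_ne_zero.2 hf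
    have key : ∀ g, T g = (inner ℂ (T.symm f) f / inner ℂ f f) • g := fun g => by
      have h1 := ae_ae_eq_of_inner_heisenbergOp_eq hκ (f := f) (g := T g) (f' := T.symm f)
        (g' := g) fun ζ => by
          rw [← T.inner_map_map _ g, hT, T.apply_symm_apply]
      refine Lp.ext ?_
      filter_upwards [h1, Lp.coeFn_smul (inner ℂ (T.symm f) f / inner ℂ f f) g] with x hx hx'
      rw [hx', Pi.smul_apply, smul_eq_mul, div_mul_eq_mul_div, eq_div_iff hff, L2.inner_def,
        L2.inner_def, ← integral_const_mul, ← integral_mul_const]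
      -- The identity between functions of `(x, y)` is integrated against `f y`.
      refine integral_congr_ae ?_
      filter_upwards [hx] with y hy
      simp only [RCLike.inner_apply] at hy ⊢
      linear_combination (f y) * hy
    refine ⟨_, ?_, key⟩
    have h2 := T.norm_map f
    rw [key, norm_smul] at h2
    exact mul_right_cancel₀ (norm_ne_zero_iff.2 hf) (h2.trans (one_mul _).symm)
  · push Not at h0
    exact ⟨1, by simp, fun f => by rw [h0 f, h0 (T 0), smul_zero]⟩

/-- Two unitary operators that implement the same linear map differ by a phase. -/
theorem Intertwines.exists_smul {n : ℕ} {κ : ℝ} (hκ : κ ≠ 0)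
    {S : (Conf n × Conf n) ≃ₗ[ℝ] (Conf n × Conf n)} {T T' : L2 n ≃ₗᵢ[ℂ] L2 n}
    (h : Intertwines κ S T) (h' : Intertwines κ S T') :
    ∃ c : ℂ, ‖c‖ = 1 ∧ ∀ f, T' f = c • T f := by
  obtain ⟨c, hc, hc'⟩ := exists_smul_of_commutes_heisenbergOp hκ (T'.trans T.symm) fun ζ f => by
    simpa using h'.trans h.symm ζ f
  refine ⟨c, hc, fun f => ?_⟩
  rw [← map_smul, ← hc' f]
  simp

/-- Phase space `ℝ²ⁿ` as the product of its two coordinate subspaces. -/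
def phaseEquiv (n : ℕ) : (Conf n × Conf n) ≃ₗ[ℝ] Phase n where
  toFun ζ := phasePoint ζ.1 ζ.2
  invFun z := (WithLp.toLp 2 fun i => z (.inl i), WithLp.toLp 2 fun i => z (.inr i))
  map_add' ζ η := by ext i; cases i <;> simp [phasePoint]
  map_smul' c ζ := by ext i; cases i <;> simp [phasePoint]
  left_inv ζ := by ext i <;> simp [phasePoint]
  right_inv z := by ext i; cases i <;> simp [phasePoint]

theorem inner_phasePoint {n : ℕ} (p q x ξ : Conf n) :
    inner ℝ (phasePoint p q) (phasePoint x ξ) = inner ℝ p x + inner ℝ q ξ := by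
  simp [phasePoint, PiLp.inner_apply]

/-- The symbol `z ↦ e^{2πiκ⟨w, z⟩}`. -/
noncomputable def expSymbol {n : ℕ} (κ : ℝ) (w z : Phase n) : ℂ :=
  Real.fourierChar (κ * inner ℝ w z)

theorem isSymbol_expSymbol {n : ℕ} (κ : ℝ) (w : Phase n) : IsSymbol (expSymbol κ w) := by
  let L : Phase n →L[ℝ] ℝ := κ • innerSL ℝ w
  have h : expSymbol κ w = (fun t : ℝ => (Real.fourierChar t : ℂ)) ∘ L := rfl
  rw [h]
  refine ⟨contDiff_fourierChar.comp L.contDiff, fun k => ⟨(2 * Real.pi) ^ k * ‖L‖ ^ k, fun z => ?_⟩⟩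
  rw [L.iteratedFDeriv_comp_right contDiff_fourierChar _ (by exact_mod_cast le_top)]
  refine (ContinuousMultilinearMap.norm_compContinuousLinearMap_le _ _).trans ?_
  rw [norm_iteratedFDeriv_fourierChar]
  simp

/-- The inner integral is the Fourier transform of `y ↦ e^{πiκ⟨p, y⟩} u(y)` at `κξ`, and the
outer one inverts it at the point `x + q`. -/
theorem weylFormula_expSymbol {n : ℕ} {κ : ℝ} (hκ : 0 < κ) (ζ : Conf n × Conf n)
    (u : 𝓢(Conf n, ℂ)) (x : Conf n) :
    weylFormula (2 * Real.pi * κ)⁻¹ (expSymbol κ (phaseEquiv n ζ)) u x =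
      weylPhase κ ζ x * u (x + ζ.2) := by
  obtain ⟨p, q⟩ := ζ
  have hg : Function.HasTemperateGrowth fun y =>
      (Real.fourierChar (κ * (inner ℝ p y / 2)) : ℂ) :=
    hasTemperateGrowth_fourierChar.comp <| (Function.HasTemperateGrowth.const κ).mul <|
      (Function.hasTemperateGrowth_inner_right p).mul (.const (2⁻¹ : ℝ))
  let v : 𝓢(Conf n, ℂ) := SchwartzMap.smulLeftCLM ℂ
    (fun y => (Real.fourierChar (κ * (inner ℝ p y / 2)) : ℂ)) u
  have hv : ∀ y, v y = (Real.fourierChar (κ * (inner ℝ p y / 2)) : ℂ) * u y := fun y =>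
    SchwartzMap.smulLeftCLM_apply_apply hg u y
  have h1 : ∀ ξ y : Conf n, Complex.exp (Complex.I / (((2 * Real.pi * κ)⁻¹ : ℝ) : ℂ) *
        ((inner ℝ ξ (x - y) : ℝ) : ℂ)) *
        expSymbol κ (phaseEquiv n (p, q)) (phasePoint ((2⁻¹ : ℝ) • (x + y)) ξ) * u y =
      Real.fourierChar (κ * (inner ℝ p x / 2)) * Real.fourierChar (inner ℝ (κ • ξ) (x + q)) *
        (Real.fourierChar (-inner ℝ y (κ • ξ)) * v y) := fun ξ y => by
    have h2 : Complex.exp (Complex.I / (((2 * Real.pi * κ)⁻¹ : ℝ) : ℂ) *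
        ((inner ℝ ξ (x - y) : ℝ) : ℂ)) = Real.fourierChar (κ * inner ℝ ξ (x - y)) := by
      rw [fourierChar_eq_cexp]
      congr 1
      push_cast
      rw [div_inv_eq_mul]
      ring
    rw [h2, hv, expSymbol, ← mul_assoc, ← mul_assoc]
    simp only [← Circle.coe_mul, ← AddChar.map_add_eq_mul]
    congr 3
    change _ + κ * inner ℝ (phasePoint p q) _ = _
    rw [inner_phasePoint]
    simp [inner_add_right, inner_sub_left, inner_smul_left, inner_smul_right,
      real_inner_comm _ ξ]
    ring
  have h3 : ∀ ξ : Conf n, ∫ y, (Real.fourierChar (-inner ℝ y (κ • ξ)) : ℂ) * v y =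
      𝓕 v (κ • ξ) := fun ξ => by
    rw [SchwartzMap.fourier_coe, Real.fourier_eq]
    rfl
  have h4 : ∫ ξ : Conf n, (Real.fourierChar (inner ℝ ξ (x + q)) : ℂ) * 𝓕 v ξ = v (x + q) := by
    have h5 : 𝓕⁻ (𝓕 v) (x + q) = v (x + q) := by rw [FourierTransform.fourierInv_fourier_eq]
    rw [← h5, SchwartzMap.fourierInv_coe, Real.fourierInv_eq]
    rfl
  have h6 := Measure.integral_comp_smul (volume : Measure (Conf n))
    (fun ξ : Conf n => (Real.fourierChar (inner ℝ ξ (x + q)) : ℂ) * 𝓕 v ξ) κ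
  have h7 : ((((2 * Real.pi * (2 * Real.pi * κ)⁻¹) ^ n)⁻¹ : ℝ) : ℂ) * ((κ ^ n)⁻¹ : ℝ) = 1 := by
    rw [← Complex.ofReal_mul, ← Complex.ofReal_one]
    congr 1
    have : 2 * Real.pi * (2 * Real.pi * κ)⁻¹ = κ⁻¹ := by
      field_simp
    rw [this, ← mul_inv, ← mul_pow, inv_mul_cancel₀ hκ.ne']
    simp
  unfold weylFormula
  generalize ((((2 * Real.pi * (2 * Real.pi * κ)⁻¹) ^ n)⁻¹ : ℝ) : ℂ) = A at h7 ⊢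
  simp_rw [h1, integral_const_mul, h3, mul_assoc, integral_const_mul]
  rw [h6, h4, hv, finrank_euclideanSpace_fin, abs_of_pos (by positivity), Complex.real_smul]
  have h8 : (weylPhase κ (p, q) x : ℂ) = Real.fourierChar (κ * (inner ℝ p x / 2)) *
      Real.fourierChar (κ * (inner ℝ p (x + q) / 2)) := by
    rw [← Circle.coe_mul, ← AddChar.map_add_eq_mul, weylPhase]
    congr 2
    simp [inner_add_right]
    ring
  rw [h8]
  linear_combination (Real.fourierChar (κ * (inner ℝ p x / 2)) : ℂ) *
      Real.fourierChar (κ * (inner ℝ p (x + q) / 2)) * u (x + q) * h7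

/-- Quantizing an exponential of a linear form gives a Weyl–Heisenberg operator. -/
theorem isWeylOp_heisenbergOp {n : ℕ} {κ : ℝ} (hκ : 0 < κ) (ζ : Conf n × Conf n) :
    IsWeylOp (2 * Real.pi * κ)⁻¹ (expSymbol κ (phaseEquiv n ζ))
      (heisenbergOp κ ζ).toContinuousLinearMap := fun u => by
  refine (coeFn_heisenbergOp κ ζ _).trans ?_
  filter_upwards [(measurePreserving_add_right volume ζ.2).quasiMeasurePreserving.ae
    (u.coeFn_toLp 2 volume)] with x hx
  rw [weylFormula_expSymbol hκ, hx]

/-- A metaplectic operator conjugates Weyl–Heisenberg operators through the transposed matrix. -/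
theorem IsMetaplectic.symm_heisenbergOp {n N : ℕ} (hN : 0 < N)
    {M : Matrix (Fin n ⊕ Fin n) (Fin n ⊕ Fin n) ℝ} {T : L2 n ≃ₗᵢ[ℂ] L2 n}
    (hT : IsMetaplectic N M T) (ζ ζ' : Conf n × Conf n)
    (h : phaseEquiv n ζ' = Matrix.toEuclideanCLM (𝕜 := ℝ) Mᵀ (phaseEquiv n ζ)) (f : L2 n) :
    T.symm (heisenbergOp N ζ (T f)) = heisenbergOp N ζ' f := by
  have hN' : (0 : ℝ) < N := by exact_mod_cast hN
  refine hT (expSymbol N (phaseEquiv n ζ)) (isSymbol_expSymbol _ _) _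
    (heisenbergOp N ζ').toContinuousLinearMap
    (isWeylOp_heisenbergOp hN' ζ) ?_ f
  convert isWeylOp_heisenbergOp hN' ζ' using 2 with z
  rw [h, ← Matrix.conjTranspose_eq_transpose_of_trivial, ← Matrix.star_eq_conjTranspose,
    map_star, ContinuousLinearMap.star_eq_adjoint]
  simp only [expSymbol, ContinuousLinearMap.adjoint_inner_left]

/-! ### Symplectic linear algebra -/

/-- The standard symplectic form on `(p, q)`-space. -/
noncomputable def sympForm {n : ℕ} (ζ η : Conf n × Conf n) : ℝ :=
  inner ℝ ζ.1 η.2 - inner ℝ ζ.2 η.1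

/-- `S` preserves the standard symplectic form. -/
def IsSymplecticMap {n : ℕ} (S : (Conf n × Conf n) ≃ₗ[ℝ] (Conf n × Conf n)) : Prop :=
  ∀ ζ η, sympForm (S ζ) (S η) = sympForm ζ η

namespace IsSymplecticMap
variable {n : ℕ} {S S' : (Conf n × Conf n) ≃ₗ[ℝ] (Conf n × Conf n)}

theorem trans (h : IsSymplecticMap S) (h' : IsSymplecticMap S') :
    IsSymplecticMap (S.trans S') := fun _ _ => (h' _ _).trans (h _ _)

theorem symm (h : IsSymplecticMap S) : IsSymplecticMap S.symm := fun ζ η => by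
  simpa using (h (S.symm ζ) (S.symm η)).symm

end IsSymplecticMap

theorem isSymplecticMap_lowerShear {n : ℕ} {B : Conf n →ₗ[ℝ] Conf n} (hB : B.IsSymmetric) :
    IsSymplecticMap (lowerShear B) := fun ζ η => by
  simp [sympForm, lowerShear, inner_sub_left, inner_sub_right, hB ζ.2 η.2]

theorem isSymplecticMap_upperShear {n : ℕ} {C : Conf n →ₗ[ℝ] Conf n} (hC : C.IsSymmetric) :
    IsSymplecticMap (upperShear C) := fun ζ η => by
  simp [sympForm, upperShear, inner_add_left, inner_add_right, hC ζ.1 η.1]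

theorem isSymplecticMap_diagonalMap {n : ℕ} (E : GL (Fin n) ℝ) :
    IsSymplecticMap (diagonalMap E) := fun ζ η => by
  have h : ∀ p q : Conf n,
      inner ℝ (ContinuousLinearMap.adjoint (invAct E) p) (invAct E⁻¹ q) = inner ℝ p q :=
    fun p q => by rw [ContinuousLinearMap.adjoint_inner_left, invAct_invAct]
  simp only [sympForm, diagonalMap, LinearEquiv.coe_mk, LinearMap.coe_mk, AddHom.coe_mk, h]
  rw [real_inner_comm _ (invAct E⁻¹ ζ.2), h, real_inner_comm η.1]

/-- The symplectic form vanishes on `L`. -/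
def IsIsotropic {n : ℕ} (L : Submodule ℝ (Conf n × Conf n)) : Prop :=
  ∀ ζ ∈ L, ∀ η ∈ L, sympForm ζ η = 0

theorem IsIsotropic.map {n : ℕ} {L : Submodule ℝ (Conf n × Conf n)} (h : IsIsotropic L)
    {S : (Conf n × Conf n) ≃ₗ[ℝ] (Conf n × Conf n)} (hS : IsSymplecticMap S) :
    IsIsotropic (L.map S.toLinearMap) := by
  rintro _ ⟨ζ, hζ, rfl⟩ _ ⟨η, hη, rfl⟩
  exact (hS ζ η).trans (h ζ hζ η hη)

/-- Vectors `(-t q_t, q_t)` of an isotropic subspace have pairwise orthogonal `q_t` for distinct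
`t`, so for some `t` there is no such vector except `0`. -/
theorem IsIsotropic.exists_transverse {n : ℕ} {L : Submodule ℝ (Conf n × Conf n)}
    (h : IsIsotropic L) : ∃ t : ℝ, ∀ v ∈ L, v.1 + t • v.2 = 0 → v = 0 := by
  by_contra! H
  choose v hv hv0 hv1 using H
  have h1 : ∀ t, (v t).1 = -(t • (v t).2) := fun t => eq_neg_of_add_eq_zero_left (hv0 t)
  have h2 : ∀ t, (v t).2 ≠ 0 := fun t h0 => hv1 t (Prod.ext (by simp [h1 t, h0]) h0)
  have h3 : Pairwise fun s t => inner ℝ (v s).2 (v t).2 = 0 := fun s t hst => by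
    have := h _ (hv s) _ (hv t)
    rw [sympForm, h1 s, h1 t, inner_neg_left, inner_neg_right, real_inner_smul_left,
      real_inner_smul_right] at this
    have h4 : (t - s) * inner ℝ (v s).2 (v t).2 = 0 := by linarith
    exact (mul_eq_zero.1 h4).resolve_left (sub_ne_zero.2 hst.symm)
  have h5 : LinearIndependent ℝ fun t => (v t).2 :=
    linearIndependent_of_ne_zero_of_inner_eq_zero h2 h3
  have := h5.finite
  exact not_finite ℝ

/-- By `IsIsotropic.exists_transverse`, `(p, q) ↦ p + tq` is injective on `L` for some `t`. -/
theorem IsIsotropic.finrank_le {n : ℕ} {L : Submodule ℝ (Conf n × Conf n)}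
    (h : IsIsotropic L) : Module.finrank ℝ L ≤ n := by
  obtain ⟨t, ht⟩ := h.exists_transverse
  have := LinearMap.finrank_le_finrank_of_injective
    (f := (LinearMap.fst ℝ (Conf n) (Conf n) + t • LinearMap.snd ℝ (Conf n) (Conf n)).comp
      L.subtype)
    ((injective_iff_map_eq_zero _).2 fun v hv => Subtype.ext (ht v v.2 hv))
  simpa using this

/-- An `n`-dimensional subspace on which `f` is injective is a graph over the values of `f`. -/
theorem exists_linearMap_of_injective {n : ℕ} {L : Submodule ℝ (Conf n × Conf n)}
    (hL : Module.finrank ℝ L = n) (f g : (Conf n × Conf n) →ₗ[ℝ] Conf n)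
    (hf : ∀ v ∈ L, f v = 0 → v = 0) :
    ∃ B : Conf n →ₗ[ℝ] Conf n, (∀ v ∈ L, g v = B (f v)) ∧ ∀ p, ∃ v ∈ L, f v = p := by
  have hinj : Function.Injective (f.comp L.subtype) :=
    (injective_iff_map_eq_zero _).2 fun v hv => Subtype.ext (hf v v.2 hv)
  let e : L ≃ₗ[ℝ] Conf n :=
    LinearEquiv.ofInjectiveOfFinrankEq (f.comp L.subtype) hinj (by simp [hL])
  have he : ∀ v : L, e v = f v := fun v => rfl
  refine ⟨(g.comp L.subtype).comp e.symm.toLinearMap, fun v hv => ?_, fun p =>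
    ⟨e.symm p, (e.symm p).2, by rw [← he, e.apply_symm_apply]⟩⟩
  have : e.symm (f v) = ⟨v, hv⟩ := by rw [LinearEquiv.symm_apply_eq, he]
  simp [this]

/-- Two isotropic subspaces that span are carried by shears to the two coordinate subspaces. -/
theorem exists_shears_of_isotropic {n : ℕ} {Ls Lu : Submodule ℝ (Conf n × Conf n)}
    (hs : IsIsotropic Ls) (hu : IsIsotropic Lu) (hsu : Ls ⊔ Lu = ⊤) :
    ∃ D : (Conf n × Conf n) ≃ₗ[ℝ] (Conf n × Conf n), IsSymplecticMap D ∧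
      (∀ κ : ℝ, κ ≠ 0 → IsImplementable κ D) ∧
        (∀ v ∈ Ls, (D v).2 = 0) ∧ ∀ v ∈ Lu, (D v).1 = 0 := by
  have hdim : Module.finrank ℝ Ls = n ∧ Module.finrank ℝ Lu = n := by
    have h1 := Submodule.finrank_add_le_finrank_add_finrank Ls Lu
    rw [hsu, finrank_top, Module.finrank_prod, finrank_euclideanSpace_fin] at h1
    have := hs.finrank_le
    have := hu.finrank_le
    omega
  obtain ⟨t, ht⟩ := hs.exists_transverse
  let B₁ : Conf n →ₗ[ℝ] Conf n := (-t) • LinearMap.id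
  have hB₁ : B₁.IsSymmetric := LinearMap.IsSymmetric.id.smul (by simp)
  let D₁ := lowerShear B₁
  have hD₁ := isSymplecticMap_lowerShear hB₁
  have hdim' : ∀ (L : Submodule ℝ (Conf n × Conf n))
      (D : (Conf n × Conf n) ≃ₗ[ℝ] (Conf n × Conf n)),
      Module.finrank ℝ (L.map D.toLinearMap) = Module.finrank ℝ L :=
    fun L D => LinearEquiv.finrank_map_eq D L
  have hD₁v : ∀ v, D₁ v = (v.1 + t • v.2, v.2) := fun v => by simp [D₁, B₁, lowerShear]
  obtain ⟨B, hB, hB'⟩ := exists_linearMap_of_injective ((hdim' Ls D₁).trans hdim.1)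
    (LinearMap.fst ℝ _ _) (LinearMap.snd ℝ _ _) (by
      rintro _ ⟨v, hv, rfl⟩ h0
      have : v.1 + t • v.2 = 0 := by
        rw [← h0]
        exact (congrArg Prod.fst (hD₁v v)).symm
      simp [ht v hv this])
  have hBs : B.IsSymmetric := fun x y => by
    obtain ⟨v, hv, rfl⟩ := hB' x
    obtain ⟨w, hw, rfl⟩ := hB' y
    rw [← hB v hv, ← hB w hw]
    have := (hs.map hD₁) v hv w hw
    rw [sympForm] at this
    simp only [LinearMap.fst_apply, LinearMap.snd_apply]
    linarith
  have hBn : (-B).IsSymmetric := fun x y => by simp [hBs x y]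
  let D₂ := D₁.trans (upperShear (-B))
  have hD₂ : IsSymplecticMap D₂ := hD₁.trans (isSymplecticMap_upperShear hBn)
  have h2 : ∀ v ∈ Ls, (D₂ v).2 = 0 := fun v hv => by
    have := hB (D₁ v) ⟨v, hv, rfl⟩
    simp only [LinearMap.fst_apply, LinearMap.snd_apply] at this
    simp [D₂, upperShear, this]
  -- A vector of the second subspace with vanishing `q` is orthogonal to both subspaces.
  have h3 : ∀ v ∈ Lu.map D₂.toLinearMap, LinearMap.snd ℝ _ _ v = 0 → v = 0 := by
    rintro _ ⟨v, hv, rfl⟩ h0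
    have h4 : ∀ η, sympForm v η = 0 := fun η => by
      obtain ⟨s, hs', u, hu', rfl⟩ := Submodule.mem_sup.1 (hsu ▸ Submodule.mem_top : η ∈ Ls ⊔ Lu)
      have h5 : sympForm v s = 0 := by
        rw [← hD₂, sympForm, h2 s hs', show (D₂ v).2 = 0 from h0]
        simp
      have h6 := hu v hv u hu'
      unfold sympForm at h5 h6 ⊢
      simp only [Prod.fst_add, Prod.snd_add, inner_add_right]
      linarith
    have h7 := h4 (-v.2, v.1)
    have h8 : v = 0 := by
      simp only [sympForm, inner_neg_right, sub_neg_eq_add] at h7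
      have h9 := real_inner_self_nonneg (x := v.1)
      have h10 := real_inner_self_nonneg (x := v.2)
      exact Prod.ext (inner_self_eq_zero (𝕜 := ℝ).1 (by linarith))
        (inner_self_eq_zero (𝕜 := ℝ).1 (by linarith))
    simp [h8]
  obtain ⟨C, hC, hC'⟩ := exists_linearMap_of_injective ((hdim' Lu D₂).trans hdim.2)
    (LinearMap.snd ℝ _ _) (LinearMap.fst ℝ _ _) h3
  have hCs : C.IsSymmetric := fun x y => by
    obtain ⟨v, hv, rfl⟩ := hC' x
    obtain ⟨w, hw, rfl⟩ := hC' y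
    rw [← hC v hv, ← hC w hw]
    have := (hu.map hD₂) v hv w hw
    rw [sympForm] at this
    simp only [LinearMap.fst_apply, LinearMap.snd_apply]
    linarith
  refine ⟨D₂.trans (lowerShear C), hD₂.trans (isSymplecticMap_lowerShear hCs), fun κ hκ =>
    ((isImplementable_lowerShear κ B₁ hB₁).trans
      (isImplementable_upperShear hκ _ hBn)).trans (isImplementable_lowerShear κ C hCs),
    h2, fun v hv => ?_⟩
  have := hC (D₂ v) ⟨v, hv, rfl⟩
  simp only [LinearMap.fst_apply, LinearMap.snd_apply] at this
  simp [lowerShear, this]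

/-! ### Stable and unstable subspaces -/

/-- The orbit of `v` under `f` tends to `0`. -/
def IsStable {V : Type*} [TopologicalSpace V] [Zero V] (f : V → V) (v : V) : Prop :=
  Tendsto (fun k => f^[k] v) atTop (𝓝 0)

theorem IsStable.of_semiconj {V W : Type*} [TopologicalSpace V] [Zero V] [TopologicalSpace W]
    [Zero W] {f : V → V} {g : W → W} {ρ : V → W} (hρ : Continuous ρ) (h0 : ρ 0 = 0)
    (h : Function.Semiconj ρ f g) {v : V} (hv : IsStable f v) : IsStable g (ρ v) := by
  have h1 := (hρ.tendsto 0).comp hv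
  rw [h0] at h1
  exact h1.congr fun k => h.iterate_right k v

theorem IsStable.apply {V : Type*} [TopologicalSpace V] [Zero V] {f : V → V} {v : V}
    (h : IsStable f v) : IsStable f (f v) :=
  (tendsto_add_atTop_iff_nat 1).2 h

/-- The vectors whose orbit under `f` tends to `0`. -/
def stableSubmodule {𝕜 V : Type*} [NormedField 𝕜] [NormedAddCommGroup V] [NormedSpace 𝕜 V]
    (f : V →ₗ[𝕜] V) : Submodule 𝕜 V where
  carrier := {v | IsStable f v}
  add_mem' {v w} hv hw := by
    have := Tendsto.add hv hw
    rw [add_zero] at this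
    refine this.congr fun k => ?_
    simp [← Module.End.coe_pow]
  zero_mem' := by
    refine tendsto_const_nhds.congr fun k => ?_
    simp
  smul_mem' c v hv := by
    have := Tendsto.const_smul hv c
    rw [smul_zero] at this
    refine this.congr fun k => ?_
    simp [← Module.End.coe_pow]

theorem tendsto_zero_of_le_mul_add {r : ℝ} (hr0 : 0 ≤ r) (hr : r < 1) {x b : ℕ → ℝ}
    (hx : ∀ k, 0 ≤ x k) (hb : Tendsto b atTop (𝓝 0)) (h : ∀ k, x (k + 1) ≤ r * x k + b k) :
    Tendsto x atTop (𝓝 0) := by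
  rw [Metric.tendsto_atTop]
  intro ε hε
  have hδ : 0 < (1 - r) * (ε / 2) := mul_pos (sub_pos.2 hr) (half_pos hε)
  obtain ⟨K, hK⟩ := eventually_atTop.1 (hb.eventually (gt_mem_nhds hδ))
  have h1 : ∀ j, x (K + j) ≤ r ^ j * x K + ε / 2 := fun j => by
    induction j with
    | zero => simpa using (half_pos hε).le
    | succ j ih =>
      have h2 := h (K + j)
      have h3 := hK (K + j) (by omega)
      have h4 := mul_le_mul_of_nonneg_left ih hr0
      rw [← add_assoc, pow_succ]
      linarith
  have h2 : Tendsto (fun j => r ^ j * x K) atTop (𝓝 (0 * x K)) :=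
    (tendsto_pow_atTop_nhds_zero_of_lt_one hr0 hr).mul_const _
  rw [zero_mul] at h2
  obtain ⟨J, hJ⟩ := eventually_atTop.1 (h2.eventually (gt_mem_nhds (half_pos hε)))
  refine ⟨K + J, fun k hk => ?_⟩
  obtain ⟨j, rfl⟩ := Nat.exists_eq_add_of_le (le_trans (Nat.le_add_right K J) hk)
  have h3 := hJ j (by omega)
  have h4 := h1 j
  rw [Real.dist_eq, sub_zero, abs_of_nonneg (hx _)]
  linarith

/-- The step of an induction along a generalized eigenspace for an eigenvalue in the open unit
disc. -/
theorem IsStable.of_sub_smul {V : Type*} [NormedAddCommGroup V] [NormedSpace ℂ V]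
    (f : V →ₗ[ℂ] V) {μ : ℂ} (hμ : ‖μ‖ < 1) {v : V} (h : IsStable f (f v - μ • v)) :
    IsStable f v := by
  refine tendsto_zero_iff_norm_tendsto_zero.2 ?_
  refine tendsto_zero_of_le_mul_add (norm_nonneg μ) hμ (fun _ => norm_nonneg _)
    (tendsto_zero_iff_norm_tendsto_zero.1 h) fun k => ?_
  have h1 : f^[k + 1] v = μ • f^[k] v + f^[k] (f v - μ • v) := by
    rw [Function.iterate_succ_apply]
    simp [← Module.End.coe_pow]
  rw [h1, ← norm_smul]
  exact norm_add_le _ _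

/-- For a linear automorphism `K` without eigenvalues on the unit circle and its inverse `K'`,
every vector is the sum of one that is stable under `K` and one that is stable under `K'`, since
this holds on each generalized eigenspace. -/
theorem stableSubmodule_sup_eq_top {V : Type*} [NormedAddCommGroup V] [NormedSpace ℂ V]
    [FiniteDimensional ℂ V] (K K' : V →ₗ[ℂ] V)
    (hKK : ∀ v, K' (K v) = v)
    (hK : ∀ z : ℂ, Module.End.HasEigenvalue K z → ‖z‖ ≠ 1) :
    stableSubmodule K ⊔ stableSubmodule K' = ⊤ := by
  rw [eq_top_iff, ← Module.End.iSup_maxGenEigenspace_eq_top K]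
  refine iSup_le fun μ v hv => ?_
  obtain ⟨m, hm⟩ := (Module.End.mem_maxGenEigenspace _ _ _).1 hv
  clear hv
  rcases lt_trichotomy ‖μ‖ 1 with hμ | hμ | hμ
  · refine Submodule.mem_sup_left ?_
    induction m generalizing v with
    | zero =>
      have : v = 0 := by simpa using hm
      rw [this]
      exact Submodule.zero_mem _
    | succ m ih =>
      refine IsStable.of_sub_smul K hμ ?_
      exact ih _ (by rw [pow_succ] at hm; simpa using hm)
  · suffices v = 0 by rw [this]; exact Submodule.zero_mem _
    induction m generalizing v with
    | zero => simpa using hm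
    | succ m ih =>
      have h1 := ih (K v - μ • v) (by rw [pow_succ] at hm; simpa using hm)
      by_contra h0
      exact hK μ (Module.End.hasEigenvalue_of_hasEigenvector
        (Module.End.hasEigenvector_iff.2
          ⟨Module.End.mem_eigenspace_iff.2 (sub_eq_zero.1 h1), h0⟩)) hμ
  · refine Submodule.mem_sup_right ?_
    have hμ0 : μ ≠ 0 := fun h => by simp [h] at hμ; linarith
    induction m generalizing v with
    | zero =>
      have : v = 0 := by simpa using hm
      rw [this]
      exact Submodule.zero_mem _
    | succ m ih =>
      have h1 : IsStable K' (K v - μ • v) := ih _ (by rw [pow_succ] at hm; simpa using hm)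
      have hμ' : ‖μ⁻¹‖ < 1 := by
        rw [norm_inv]
        exact inv_lt_one_of_one_lt₀ hμ
      refine IsStable.of_sub_smul K' hμ' ?_
      have h2 : K' v - μ⁻¹ • v = (-μ⁻¹) • K' (K v - μ • v) := by
        simp only [map_sub, map_smul, hKK, smul_sub, smul_smul, neg_mul, inv_mul_cancel₀ hμ0]
        module
      exact h2 ▸ (stableSubmodule K').smul_mem _ h1.apply

/-- The map of `(p, q)`-space given by a matrix. -/
noncomputable def phaseMap {n : ℕ} (P : Matrix (Fin n ⊕ Fin n) (Fin n ⊕ Fin n) ℝ) :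
    (Conf n × Conf n) →ₗ[ℝ] (Conf n × Conf n) :=
  (phaseEquiv n).symm.toLinearMap ∘ₗ (Matrix.toEuclideanCLM (𝕜 := ℝ) P).toLinearMap ∘ₗ
    (phaseEquiv n).toLinearMap

theorem phaseMap_phaseMap {n : ℕ} {P Q : Matrix (Fin n ⊕ Fin n) (Fin n ⊕ Fin n) ℝ}
    (h : P * Q = 1) (ζ : Conf n × Conf n) : phaseMap P (phaseMap Q ζ) = ζ := by
  have h1 : Matrix.toEuclideanCLM (𝕜 := ℝ) P * Matrix.toEuclideanCLM (𝕜 := ℝ) Q = 1 := by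
    rw [← map_mul, h, map_one]
  have h2 := congrArg (fun L : Phase n →L[ℝ] Phase n => L (phaseEquiv n ζ)) h1
  simp only [mul_apply_eq_comp, one_apply_eq_self] at h2
  simp [phaseMap, h2]

/-- The real part of a complex vector, as a point of `(p, q)`-space. -/
noncomputable def rePhase {n : ℕ} (z : Fin n ⊕ Fin n → ℂ) : Conf n × Conf n :=
  (phaseEquiv n).symm (WithLp.toLp 2 fun i => (z i).re)

theorem continuous_rePhase (n : ℕ) : Continuous (rePhase (n := n)) :=
  (LinearMap.continuous_of_finiteDimensional (phaseEquiv n).symm.toLinearMap).comp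
    ((PiLp.continuous_toLp 2 _).comp (by fun_prop))

theorem rePhase_mulVec {n : ℕ} (P : Matrix (Fin n ⊕ Fin n) (Fin n ⊕ Fin n) ℝ)
    (z : Fin n ⊕ Fin n → ℂ) :
    rePhase ((P.map (algebraMap ℝ ℂ)) *ᵥ z) = phaseMap P (rePhase z) := by
  simp only [rePhase, phaseMap, LinearMap.comp_apply, LinearEquiv.coe_coe,
    LinearEquiv.apply_symm_apply]
  congr 1
  ext i
  simp [Matrix.mulVec, dotProduct]

theorem IsHyperbolic.transpose {ι : Type*} [Fintype ι] [DecidableEq ι] {M : Matrix ι ι ℝ}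
    (h : IsHyperbolic M) : IsHyperbolic Mᵀ := fun z hz => h z <| by
  rw [Module.End.hasEigenvalue_iff_isRoot_charpoly] at hz ⊢
  rwa [Matrix.transpose_map, Matrix.charpoly_toLin', Matrix.charpoly_transpose,
    ← Matrix.charpoly_toLin'] at hz

/-- The decomposition into stable and unstable parts exists over `ℂ`; the real parts of the two
components of a real vector are again stable, since `P` and `Q` are real. -/
theorem exists_stable_add_stable {n : ℕ} {P Q : Matrix (Fin n ⊕ Fin n) (Fin n ⊕ Fin n) ℝ}
    (hPQ : P * Q = 1) (hP : IsHyperbolic P) (ζ : Conf n × Conf n) :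
    ∃ s u, IsStable (phaseMap P) s ∧ IsStable (phaseMap Q) u ∧ s + u = ζ := by
  have hQP : Q * P = 1 := mul_eq_one_comm.1 hPQ
  have hc : ∀ {P Q : Matrix (Fin n ⊕ Fin n) (Fin n ⊕ Fin n) ℝ}, P * Q = 1 →
      P.map (algebraMap ℝ ℂ) * Q.map (algebraMap ℝ ℂ) = 1 := fun {P Q} h => by
    rw [← Matrix.map_mul, h, Matrix.map_one _ (map_zero _) (map_one _)]
  have hK := stableSubmodule_sup_eq_top (Matrix.toLin' (P.map (algebraMap ℝ ℂ)))
    (Matrix.toLin' (Q.map (algebraMap ℝ ℂ))) (fun v => by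
      rw [← Matrix.toLin'_mul_apply, hc hQP, Matrix.toLin'_one, LinearMap.id_apply]) hP
  obtain ⟨s, hs, u, hu, hsu⟩ := Submodule.mem_sup.1 (hK ▸ Submodule.mem_top :
    (fun i => ((phaseEquiv n ζ i : ℝ) : ℂ)) ∈
      stableSubmodule (Matrix.toLin' (P.map (algebraMap ℝ ℂ))) ⊔
        stableSubmodule (Matrix.toLin' (Q.map (algebraMap ℝ ℂ))))
  have h0 : rePhase (0 : Fin n ⊕ Fin n → ℂ) = 0 := by
    simp only [rePhase, Pi.zero_apply, Complex.zero_re]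
    exact map_zero (phaseEquiv n).symm
  refine ⟨rePhase s, rePhase u,
    hs.of_semiconj (continuous_rePhase n) h0 fun z => rePhase_mulVec P z,
    hu.of_semiconj (continuous_rePhase n) h0 fun z => rePhase_mulVec Q z, ?_⟩
  have h1 := congrArg rePhase hsu
  have h2 : rePhase (s + u) = rePhase s + rePhase u := by
    rw [rePhase, rePhase, rePhase, ← map_add]
    rfl
  rw [← h2, h1, rePhase]
  simp

/-! ### Normal form of a hyperbolic symplectic map -/

theorem exists_norm_pow_le_half {n : ℕ} (G : Conf n →L[ℝ] Conf n) (hG : ∀ x, IsStable G x) :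
    ∃ m, 0 < m ∧ ‖G ^ m‖ ≤ 1 / 2 := by
  have h1 : Tendsto (fun m => ∑ i, ‖(G ^ m) (EuclideanSpace.single i 1)‖) atTop (𝓝 0) := by
    rw [show (0 : ℝ) = ∑ i : Fin n, 0 by simp]
    refine tendsto_finsetSum _ fun i _ => ?_
    have := tendsto_zero_iff_norm_tendsto_zero.1 (hG (EuclideanSpace.single i 1))
    simpa [FunLike.coe_pow] using this
  obtain ⟨m, hm⟩ := eventually_atTop.1 (h1.eventually (gt_mem_nhds (by norm_num : (0 : ℝ) < 1 / 2)))
  refine ⟨m + 1, m.succ_pos, le_trans (ContinuousLinearMap.opNorm_le_bound _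
    (Finset.sum_nonneg fun _ _ => norm_nonneg _) fun x => ?_) (hm (m + 1) (by omega)).le⟩
  have hx : x = ∑ i, x i • EuclideanSpace.single i (1 : ℝ) := by
    simpa using ((EuclideanSpace.basisFun (Fin n) ℝ).sum_repr x).symm
  conv_lhs => rw [hx, map_sum]
  rw [Finset.sum_mul]
  refine (norm_sum_le _ _).trans (Finset.sum_le_sum fun i _ => ?_)
  rw [map_smul, norm_smul, mul_comm]
  exact mul_le_mul_of_nonneg_left (PiLp.norm_apply_le x i) (norm_nonneg _)

/-- A linear map all of whose orbits tend to `0` becomes a contraction in suitable coordinates: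
those in which the Euclidean norm is `x ↦ (∑_{k < m} ‖Gᵏ x‖²)^{1/2}`, with `m` such that
`‖Gᵐ‖ ≤ 1/2`. -/
theorem exists_conj_norm_lt_one {n : ℕ} (G : Conf n →L[ℝ] Conf n) (hG : ∀ x, IsStable G x) :
    ∃ R : Conf n ≃L[ℝ] Conf n,
      ‖(R : Conf n →L[ℝ] Conf n) ∘L G ∘L (R.symm : Conf n →L[ℝ] Conf n)‖ < 1 := by
  obtain ⟨m, hm0, hm⟩ := exists_norm_pow_le_half G hG
  let J : Conf n →ₗ[ℝ] PiLp 2 (fun _ : Fin m => Conf n) :=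
    (WithLp.linearEquiv 2 ℝ (Fin m → Conf n)).symm.toLinearMap ∘ₗ
      LinearMap.pi fun k => ((G ^ (k : ℕ) : Conf n →L[ℝ] Conf n) : Conf n →ₗ[ℝ] Conf n)
  have hJ : ∀ x, ‖J x‖ ^ 2 = ∑ k ∈ Finset.range m, ‖(G ^ k) x‖ ^ 2 := fun x => by
    rw [PiLp.norm_sq_eq_of_L2, Finset.sum_range]
    rfl
  have hlow : ∀ x, ‖x‖ ^ 2 ≤ ‖J x‖ ^ 2 := fun x => by
    rw [hJ]
    simpa using Finset.single_le_sum (f := fun k => ‖(G ^ k) x‖ ^ 2) (fun k _ => by positivity)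
      (Finset.mem_range.2 hm0)
  have hinj : Function.Injective J := (injective_iff_map_eq_zero J).2 fun x hx => by
    have := hlow x
    rw [hx] at this
    simpa using this
  have hfr : Module.finrank ℝ (LinearMap.range J) = n := by
    rw [LinearMap.finrank_range_of_inj hinj, finrank_euclideanSpace_fin]
  let b : LinearMap.range J ≃ₗᵢ[ℝ] Conf n :=
    ((stdOrthonormalBasis ℝ (LinearMap.range J)).reindex (finCongr hfr)).repr
  let R : Conf n ≃L[ℝ] Conf n :=
    ((LinearEquiv.ofInjective J hinj).trans b.toLinearEquiv).toContinuousLinearEquiv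
  have hR : ∀ x, ‖R x‖ = ‖J x‖ := fun x => b.norm_map _
  -- Passing from `x` to `G x` drops the term `k = 0` of the sum and adds the term `k = m`.
  have hRG : ∀ x, ‖R (G x)‖ ^ 2 ≤ ‖R x‖ ^ 2 - 3 / 4 * ‖x‖ ^ 2 := fun x => by
    have h1 := Finset.sum_range_succ (fun k => ‖(G ^ k) x‖ ^ 2) m
    rw [Finset.sum_range_succ'] at h1
    have h2 : ‖(G ^ m) x‖ ^ 2 ≤ (1 / 2 * ‖x‖) ^ 2 := by
      gcongr
      exact (G ^ m).le_of_opNorm_le hm x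
    have h3 : ∀ k, (G ^ k) (G x) = (G ^ (k + 1)) x := fun k => by
      rw [pow_succ]
      rfl
    rw [hR, hR, hJ, hJ]
    simp only [h3]
    simp only [pow_zero, one_apply_eq_self] at h1
    linarith
  let C : ℝ := ‖(R : Conf n →L[ℝ] Conf n)‖ + 1
  have hC : 1 ≤ C := by simp [C]
  have hCx : ∀ x, ‖R x‖ ≤ C * ‖x‖ := fun x =>
    (R : Conf n →L[ℝ] Conf n).le_of_opNorm_le (by simp [C]) x
  have h34 : 3 / 4 / C ^ 2 ≤ 3 / 4 := div_le_self (by norm_num) (one_le_pow₀ hC)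
  have hpos : 0 < 3 / 4 / C ^ 2 := by positivity
  refine ⟨R, lt_of_le_of_lt (ContinuousLinearMap.opNorm_le_bound _
    (Real.sqrt_nonneg (1 - 3 / 4 / C ^ 2)) fun y => ?_) ?_⟩
  · refine abs_le_of_sq_le_sq' ?_ (by positivity) |>.2
    rw [mul_pow, Real.sq_sqrt (by linarith)]
    have h1 := hRG (R.symm y)
    have h2 := hCx (R.symm y)
    rw [R.apply_symm_apply] at h1 h2
    have h3 : ‖y‖ ^ 2 ≤ C ^ 2 * ‖R.symm y‖ ^ 2 := by
      rw [← mul_pow]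
      gcongr
    have h4 : 3 / 4 / C ^ 2 * ‖y‖ ^ 2 ≤ 3 / 4 * ‖R.symm y‖ ^ 2 := by
      rw [div_mul_eq_mul_div, div_le_iff₀ (by positivity)]
      linarith
    change ‖R (G (R.symm y))‖ ^ 2 ≤ _
    linarith
  · rw [Real.sqrt_lt' one_pos]
    linarith

/-- An expanding matrix has determinant greater than `1` in absolute value: its inverse maps a
ball of radius greater than `1` into the unit ball. -/
theorem one_lt_abs_det_of_isExpanding {n : ℕ} (hn : 0 < n) {E : GL (Fin n) ℝ}
    (hE : IsExpanding E) : 1 < |E.val.det| := by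
  obtain ⟨r, hr, hr1⟩ := exists_between hE
  have hr0 : 0 < r := (norm_nonneg _).trans_lt hr
  have hsub : Metric.ball (0 : Conf n) r⁻¹ ⊆ invAct E ⁻¹' Metric.ball 0 1 := fun x hx => by
    rw [mem_ball_zero_iff] at hx
    rw [Set.mem_preimage, mem_ball_zero_iff]
    calc ‖invAct E x‖ ≤ r * ‖x‖ := (invAct E).le_of_opNorm_le hr.le x
      _ < r * r⁻¹ := by gcongr
      _ = 1 := mul_inv_cancel₀ hr0.ne'
  have h1 := measure_mono (μ := volume) hsub
  rw [← Measure.map_apply (invAct E).continuous.measurable measurableSet_ball, map_invAct,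
    Measure.addHaar_ball_of_pos _ _ (inv_pos.2 hr0), finrank_euclideanSpace_fin,
    Measure.smul_apply, smul_eq_mul, ENNReal.mul_le_mul_iff_left
      (Metric.measure_ball_pos _ _ one_pos).ne' measure_ball_lt_top.ne,
    ENNReal.ofReal_le_ofReal_iff (abs_nonneg _)] at h1
  exact (one_lt_pow₀ ((one_lt_inv₀ hr0).2 hr1) hn.ne').trans_le h1

theorem exists_GL_of_equiv {n : ℕ} (e : Conf n ≃L[ℝ] Conf n) :
    ∃ E : GL (Fin n) ℝ, invAct E = e.symm ∧ invAct E⁻¹ = e := by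
  let φ := Matrix.toEuclideanCLM (n := Fin n) (𝕜 := ℝ)
  refine ⟨⟨φ.symm e, φ.symm e.symm, ?_, ?_⟩, ?_, ?_⟩
  · rw [← map_mul, ← map_one φ.symm]
    congr 1
    ext1 x
    exact e.apply_symm_apply x
  · rw [← map_mul, ← map_one φ.symm]
    congr 1
    ext1 x
    exact e.symm_apply_apply x
  · exact φ.apply_symm_apply _
  · exact φ.apply_symm_apply _

/-- The action of a block diagonal symplectic map on `p` is determined by its action on `q`. -/
theorem IsSymplecticMap.eq_diagonalMap {n : ℕ}
    {S : (Conf n × Conf n) ≃ₗ[ℝ] (Conf n × Conf n)} (hS : IsSymplecticMap S) {E : GL (Fin n) ℝ}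
    (h2 : ∀ ζ, (S ζ).2 = invAct E⁻¹ ζ.2) (h1 : ∀ q, (S (0, q)).1 = 0) : S = diagonalMap E := by
  ext1 ζ
  refine Prod.ext (ext_inner_right ℝ fun x => ?_) (h2 ζ)
  have h3 := hS ζ (0, invAct E x)
  have h4 : (S (0, invAct E x)).2 = x := by
    rw [h2]
    simpa using invAct_invAct E⁻¹ x
  rw [sympForm, sympForm, h1, h4] at h3
  simp only [inner_zero_right, sub_zero] at h3
  rw [h3]
  exact (ContinuousLinearMap.adjoint_inner_left _ _ _).symm

/-- The symplectic form is constant along a pair of orbits, and both orbits tend to `0`. -/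
theorem isIsotropic_stableSubmodule {n : ℕ} {A : (Conf n × Conf n) ≃ₗ[ℝ] (Conf n × Conf n)}
    (hA : IsSymplecticMap A) : IsIsotropic (stableSubmodule A.toLinearMap) := fun ζ hζ η hη => by
  have hc : Continuous fun z : (Conf n × Conf n) × (Conf n × Conf n) => sympForm z.1 z.2 := by
    unfold sympForm
    fun_prop
  have h1 := (hc.tendsto (0, 0)).comp (Tendsto.prodMk_nhds hζ hη)
  have h2 : ∀ k, sympForm (A^[k] ζ) (A^[k] η) = sympForm ζ η := fun k => by
    induction k with
    | zero => rfl
    | succ k ih => rw [Function.iterate_succ_apply', Function.iterate_succ_apply', hA, ih]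
  have h3 : Tendsto (fun _ : ℕ => sympForm ζ η) atTop (𝓝 (sympForm (0 : Conf n × Conf n) 0)) :=
    h1.congr h2
  rw [tendsto_nhds_unique tendsto_const_nhds h3]
  simp [sympForm]

theorem IsStable.apply_symm {n : ℕ} {A : (Conf n × Conf n) ≃ₗ[ℝ] (Conf n × Conf n)}
    {v : Conf n × Conf n} (h : IsStable A v) : IsStable A (A.symm v) := by
  refine (tendsto_add_atTop_iff_nat 1).1 (h.congr fun k => ?_)
  rw [Function.iterate_succ_apply, A.apply_symm_apply]

/-- A hyperbolic symplectic map is conjugate, by an implementable map, to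
`(p, q) ↦ ((Eᵀ)⁻¹ p, E q)` with `E` expanding. -/
theorem exists_conj_diagonalMap {n : ℕ} {A : (Conf n × Conf n) ≃ₗ[ℝ] (Conf n × Conf n)}
    (hA : IsSymplecticMap A)
    (hsum : ∀ ζ, ∃ s u, IsStable A s ∧ IsStable A.symm u ∧ s + u = ζ) :
    ∃ E : GL (Fin n) ℝ, IsExpanding E ∧ ∃ D : (Conf n × Conf n) ≃ₗ[ℝ] (Conf n × Conf n),
      (∀ κ : ℝ, κ ≠ 0 → IsImplementable κ D) ∧
        (D.symm.trans A).trans D = diagonalMap E := by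
  obtain ⟨D, hDs, hDi, hD2, hD1⟩ := exists_shears_of_isotropic (isIsotropic_stableSubmodule hA)
    (isIsotropic_stableSubmodule hA.symm) <| by
      refine eq_top_iff.2 fun ζ _ => ?_
      obtain ⟨s, u, hs, hu, rfl⟩ := hsum ζ
      exact Submodule.add_mem_sup hs hu
  have hAu : ∀ {u}, IsStable A.symm u → IsStable A.symm (A u) := fun hu => by
    simpa using hu.apply_symm (A := A.symm)
  -- In the coordinates `D` the map `A` acts on `q` by `b`, with inverse `b'`.
  let b : Conf n →ₗ[ℝ] Conf n := LinearMap.snd ℝ _ _ ∘ₗ (D.toLinearMap ∘ₗ A.toLinearMap ∘ₗ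
    D.symm.toLinearMap) ∘ₗ LinearMap.inr ℝ _ _
  let b' : Conf n →ₗ[ℝ] Conf n := LinearMap.snd ℝ _ _ ∘ₗ (D.toLinearMap ∘ₗ A.symm.toLinearMap ∘ₗ
    D.symm.toLinearMap) ∘ₗ LinearMap.inr ℝ _ _
  have hu' : ∀ s u, IsStable A s → IsStable A.symm u → D.symm (0, (D (s + u)).2) = u :=
    fun s u hs hu => by
      rw [LinearEquiv.symm_apply_eq, map_add]
      exact Prod.ext (hD1 u hu).symm (by simp [hD2 s hs])
  have hb : ∀ v, (D (A v)).2 = b (D v).2 := fun v => by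
    obtain ⟨s, u, hs, hu, rfl⟩ := hsum v
    change _ = (D (A (D.symm (0, (D (s + u)).2)))).2
    rw [hu' s u hs hu, map_add, map_add, Prod.snd_add, hD2 _ hs.apply, zero_add]
  have hb' : ∀ v, (D (A.symm v)).2 = b' (D v).2 := fun v => by
    obtain ⟨s, u, hs, hu, rfl⟩ := hsum v
    change _ = (D (A.symm (D.symm (0, (D (s + u)).2)))).2
    rw [hu' s u hs hu, map_add, map_add, Prod.snd_add, hD2 _ hs.apply_symm, zero_add]
  have hq : ∀ q, (D (D.symm (0, q))).2 = q := fun q => by simp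
  have hbb' : ∀ q, b (b' q) = q := fun q => by
    rw [← hq (b (b' q)), ← hq q, ← hb', ← hb]
    simp
  have hb'b : ∀ q, b' (b q) = q := fun q => by
    rw [← hq (b' (b q)), ← hq q, ← hb, ← hb']
    simp
  have hstable : ∀ q, IsStable b' q := fun q => by
    obtain ⟨s, u, hs, hu, hsu⟩ := hsum (D.symm (0, q))
    have h1 : (D u).2 = q := by
      rw [← hq q, ← hsu, map_add, Prod.snd_add, hD2 s hs, zero_add]
    rw [← h1]
    exact hu.of_semiconj (ρ := fun v => (D v).2)
      (continuous_snd.comp (LinearMap.continuous_of_finiteDimensional D.toLinearMap))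
      (by simp) hb'
  obtain ⟨R, hR⟩ := exists_conj_norm_lt_one (LinearMap.toContinuousLinearMap b') hstable
  let e : Conf n ≃L[ℝ] Conf n := (LinearEquiv.ofLinearMap b b' (LinearMap.ext hbb')
    (LinearMap.ext hb'b)).toContinuousLinearEquiv
  obtain ⟨E, hE, hE'⟩ := exists_GL_of_equiv ((R.symm.trans e).trans R)
  obtain ⟨F, hF, hF'⟩ := exists_GL_of_equiv R
  refine ⟨E, ?_, D.trans (diagonalMap F), fun κ hκ =>
    (hDi κ hκ).trans (isImplementable_diagonalMap κ F), ?_⟩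
  · change ‖invAct E‖ < 1
    rw [hE]
    exact hR
  · have hDF := hDs.trans (isSymplecticMap_diagonalMap F)
    refine ((hDF.symm.trans hA).trans hDF).eq_diagonalMap (fun ζ => ?_) fun q => ?_
    · obtain ⟨v, rfl⟩ := (D.trans (diagonalMap F)).surjective ζ
      have h1 : ∀ v, ((D.trans (diagonalMap F)) v).2 = R (D v).2 := fun v => by
        change invAct F⁻¹ (D v).2 = _
        rw [hF']
        rfl
      change (D.trans (diagonalMap F) (A ((D.trans (diagonalMap F)).symm _))).2 = _
      rw [LinearEquiv.symm_apply_apply, h1, h1,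
        hb, hE']
      simp [e]
    · obtain ⟨v, hv⟩ := (D.trans (diagonalMap F)).surjective (0, q)
      change (D.trans (diagonalMap F) (A ((D.trans (diagonalMap F)).symm _))).1 = 0
      rw [← hv, LinearEquiv.symm_apply_apply]
      have h1 : (D v).1 = 0 := by
        have h2 : D v = (diagonalMap F).symm (0, q) := by
          rw [LinearEquiv.eq_symm_apply]
          exact hv
        rw [h2]
        simp [diagonalMap]
      obtain ⟨s, u, hs, hu, rfl⟩ := hsum v
      have h3 : D s = 0 := Prod.ext (by
        rw [map_add, Prod.fst_add, hD1 u hu, add_zero] at h1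
        exact h1) (hD2 s hs)
      rw [show s = 0 by simpa using h3, zero_add]
      change ContinuousLinearMap.adjoint (invAct F) (D (A u)).1 = 0
      rw [hD1 _ (hAu hu), map_zero]

theorem sympForm_eq_dotProduct {n : ℕ} (ζ η : Conf n × Conf n) :
    sympForm ζ η = -((phaseEquiv n ζ).ofLp ⬝ᵥ
      (Matrix.J (Fin n) ℝ *ᵥ (phaseEquiv n η).ofLp)) := by
  have : (phaseEquiv n η).ofLp = Sum.elim η.1.ofLp η.2.ofLp := rfl
  rw [this, Matrix.J, Matrix.fromBlocks_mulVec]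
  simp [sympForm, phaseEquiv, phasePoint, dotProduct, PiLp.inner_apply, mul_comm, Matrix.neg_mulVec]
  ring

theorem sympForm_phaseMap {n : ℕ} {P : Matrix (Fin n ⊕ Fin n) (Fin n ⊕ Fin n) ℝ}
    (hP : P ∈ Matrix.symplecticGroup (Fin n) ℝ) (ζ η : Conf n × Conf n) :
    sympForm (phaseMap P ζ) (phaseMap P η) = sympForm ζ η := by
  have h : ∀ ζ, (phaseEquiv n (phaseMap P ζ)).ofLp = P *ᵥ (phaseEquiv n ζ).ofLp := fun ζ => by
    simp only [phaseMap, LinearMap.comp_apply, LinearEquiv.coe_coe, LinearEquiv.apply_symm_apply]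
    rfl
  rw [sympForm_eq_dotProduct, sympForm_eq_dotProduct, h, h]
  conv_rhs => rw [← SymplecticGroup.mem_iff'.1 hP, ← Matrix.mulVec_mulVec, ← Matrix.mulVec_mulVec,
    Matrix.dotProduct_mulVec _ Pᵀ, Matrix.vecMul_transpose]

/-! ### Removal of the phase -/

/-- For a linear automorphism `g` with `‖g‖ < 1`, the least integer `k(x)` with
`‖g ^ k(x) x‖ < 1` for a nonzero point `x`; it drops by one under `g`. -/
theorem exists_measurable_cocycle {n : ℕ} (g : Conf n ≃L[ℝ] Conf n)
    (hg : ‖(g : Conf n →L[ℝ] Conf n)‖ < 1) :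
    ∃ k : Conf n → ℤ, Measurable k ∧ ∀ x ≠ 0, k x = k (g x) + 1 := by
  classical
  have hgx : ∀ x, ‖g x‖ ≤ ‖(g : Conf n →L[ℝ] Conf n)‖ * ‖x‖ :=
    fun x => (g : Conf n →L[ℝ] Conf n).le_opNorm x
  have hsucc : ∀ (m : ℤ) x, (g ^ (m + 1)) x = g ((g ^ m) x) := fun m x => by
    rw [add_comm, zpow_add, zpow_one]
    rfl
  have hsucc' : ∀ (m : ℤ) x, (g ^ (m + 1)) x = (g ^ m) (g x) := fun m x => by
    rw [zpow_add, zpow_one]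
    rfl
  have hanti : ∀ x, Antitone fun m : ℤ => ‖(g ^ m) x‖ :=
    fun x => antitone_int_of_succ_le fun m => by
    rw [hsucc]
    exact (hgx _).trans (mul_le_of_le_one_left (norm_nonneg _) hg.le)
  have hpow : ∀ (m : ℕ) x, ‖(g ^ (m : ℤ)) x‖ ≤ ‖(g : Conf n →L[ℝ] Conf n)‖ ^ m * ‖x‖ :=
    fun m x => by
    induction m with
    | zero => exact (one_mul ‖x‖).ge
    | succ m ih =>
      rw [Nat.cast_succ, hsucc, pow_succ', mul_assoc]
      exact (hgx _).trans (by gcongr)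
  have hlim := tendsto_pow_atTop_nhds_zero_of_lt_one (norm_nonneg _) hg
  -- `P x m` says that `m` is the least integer with `‖(g ^ m) x‖ < 1`.
  let P : Conf n → ℤ → Prop := fun x m => ‖(g ^ m) x‖ < 1 ∧ 1 ≤ ‖(g ^ (m - 1)) x‖
  have hex : ∀ x ≠ 0, ∃ m, P x m := fun x hx => by
    have hlim' := hlim.mul_const ‖x‖
    rw [zero_mul] at hlim'
    obtain ⟨a, ha⟩ := (hlim'.eventually (gt_mem_nhds one_pos)).exists
    obtain ⟨b, hb⟩ := (hlim.eventually (gt_mem_nhds (norm_pos_iff.2 hx))).exists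
    obtain ⟨m, hm, hmin⟩ := Int.exists_least_of_bdd (P := fun m : ℤ => ‖(g ^ m) x‖ < 1)
      ⟨-(b : ℤ), fun z hz => by
        by_contra hlt
        have h1 := hpow b ((g ^ (-(b : ℤ))) x)
        have h2 : (g ^ (b : ℤ)) ((g ^ (-(b : ℤ))) x) = x := by
          change (g ^ (b : ℤ) * g ^ (-(b : ℤ))) x = x
          rw [← zpow_add, add_neg_cancel, zpow_zero]
          rfl
        rw [h2] at h1
        have h3 : ‖(g ^ (-(b : ℤ))) x‖ ≤ 1 := (hanti x (not_le.1 hlt).le).trans hz.le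
        have h4 := mul_le_mul_of_nonneg_left h3
          (pow_nonneg (norm_nonneg (g : Conf n →L[ℝ] Conf n)) b)
        linarith⟩ ⟨a, (hpow a x).trans_lt ha⟩
    refine ⟨m, hm, not_lt.1 fun h => ?_⟩
    have := hmin _ h
    omega
  have huniq : ∀ x m m', P x m → P x m' → m = m' := fun x m m' h h' => by
    have key : ∀ m m', P x m → P x m' → m ≤ m' := fun m m' h h' => by
      by_contra hlt
      have := hanti x (show m' ≤ m - 1 by omega)
      exact absurd (h.2.trans this) (not_le.2 h'.1)
    exact le_antisymm (key _ _ h h') (key _ _ h' h)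
  let k : Conf n → ℤ := fun x => if h : x ≠ 0 then (hex x h).choose else 0
  have hk : ∀ x ≠ 0, ∀ m, k x = m ↔ P x m := fun x hx m => by
    have h1 : P x (k x) := by
      simp only [k, dif_pos hx]
      exact (hex x hx).choose_spec
    exact ⟨fun h => h ▸ h1, huniq x _ _ h1⟩
  refine ⟨k, measurable_to_countable' fun m => ?_, fun x hx => ?_⟩
  · have h0 : k 0 = 0 := by simp [k]
    have hm : MeasurableSet {x | P x m} :=
      ((measurableSet_lt ((g ^ m).continuous.norm.measurable) measurable_const).inter
        (measurableSet_le measurable_const ((g ^ (m - 1)).continuous.norm.measurable)))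
    have h1 : k ⁻¹' {m} = ({x | P x m} \ {0}) ∪ ({0} ∩ {_x | (0 : ℤ) = m}) := by
      ext x
      by_cases hx : x = 0
      · simp [hx, h0]
      · simp [hx, hk x hx m]
    rw [h1]
    exact (hm.diff (measurableSet_singleton _)).union
      ((measurableSet_singleton _).inter (MeasurableSet.const _))
  · have hgx0 : g x ≠ 0 := by simpa using hx
    rw [← sub_eq_iff_eq_add, eq_comm, hk _ hgx0]
    have h1 := (hk x hx (k x)).1 rfl
    have h2 := hsucc' (k x - 1) x
    have h3 := hsucc' (k x - 1 - 1) x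
    rw [sub_add_cancel] at h2 h3
    exact ⟨h2 ▸ h1.1, h3 ▸ h1.2⟩

/-- For expanding `E` the operator `c |det E|^{-1/2} L_E`, `|c| = 1`, is unitarily equivalent to
`|det E|^{-1/2} L_E`, by multiplication by a unimodular solution `φ` of
`φ(x) = c φ(E⁻¹ x)`. -/
theorem exists_unitary_conj_smul {n : ℕ} (hn : 0 < n) {E : GL (Fin n) ℝ} (hE : IsExpanding E)
    (c : Circle) : ∃ Φ : L2 n ≃ₗᵢ[ℂ] L2 n,
      ∀ f, Φ (unitaryTransferOp E (Φ.symm f)) = (c : ℂ) • unitaryTransferOp E f := by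
  have : Nonempty (Fin n) := ⟨⟨0, hn⟩⟩
  obtain ⟨k, hk, hkE⟩ := exists_measurable_cocycle (actEquiv E).symm hE
  have hφ : Measurable fun x => ((c ^ k x : Circle) : ℂ) :=
    (measurable_from_top (f := fun m : ℤ => ((c ^ m : Circle) : ℂ))).comp hk
  refine ⟨unimodularMul (fun x => c ^ k x) hφ, fun f => Lp.ext ?_⟩
  refine (coeFn_unimodularMul _ hφ _).trans ?_
  refine .trans ?_ (Lp.coeFn_smul _ _).symm
  filter_upwards [coeFn_unitaryTransferOp E ((unimodularMul (fun x => c ^ k x) hφ).symm f),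
    coeFn_unitaryTransferOp E f, (quasiMeasurePreserving_invAct E).ae
      (coeFn_unimodularMul_symm (fun x => c ^ k x) hφ f), Measure.ae_ne volume 0] with x h1 h2 h3 h4
  rw [h1, h3, Pi.smul_apply, h2, smul_eq_mul]
  have h5 : c ^ k x * (c ^ k (invAct E x))⁻¹ = c := by
    rw [hkE x h4]
    change c ^ (k (invAct E x) + 1) * _ = c
    rw [zpow_add, zpow_one, mul_right_comm, mul_inv_cancel, one_mul]
  have h6 := congrArg (fun z : Circle => (z : ℂ)) h5
  simp only [Circle.coe_mul] at h6
  linear_combination (((|E.val.det| ^ (-(1 / 2) : ℝ) : ℝ) : ℂ) * f (invAct E x)) * h6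

/-- The linear automorphism of `(p, q)`-space given by an invertible matrix. -/
noncomputable def phaseMapEquiv {n : ℕ} {P Q : Matrix (Fin n ⊕ Fin n) (Fin n ⊕ Fin n) ℝ}
    (hPQ : P * Q = 1) (hQP : Q * P = 1) : (Conf n × Conf n) ≃ₗ[ℝ] (Conf n × Conf n) :=
  { phaseMap P with
    invFun := phaseMap Q
    left_inv := phaseMap_phaseMap hQP
    right_inv := phaseMap_phaseMap hPQ }

/-- The inverse transpose of a hyperbolic symplectic matrix, which is the map that a metaplectic
operator implements, is conjugate to `(p, q) ↦ ((Eᵀ)⁻¹ p, E q)` with `E` expanding. -/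
theorem exists_expanding_model {n : ℕ} {M : Matrix (Fin n ⊕ Fin n) (Fin n ⊕ Fin n) ℝ}
    (hM : M ∈ Matrix.symplecticGroup (Fin n) ℝ) (hyp : IsHyperbolic M) :
    ∃ E : GL (Fin n) ℝ, IsExpanding E ∧ ∃ A D : (Conf n × Conf n) ≃ₗ[ℝ] (Conf n × Conf n),
      (∀ ζ, A.symm ζ = phaseMap Mᵀ ζ) ∧ (∀ κ : ℝ, κ ≠ 0 → IsImplementable κ D) ∧
        (D.symm.trans A).trans D = diagonalMap E := by
  have hMt := SymplecticGroup.transpose_mem hM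
  have hdet : IsUnit (Mᵀ).det := SymplecticGroup.symplectic_det hMt
  obtain ⟨Q, h1, h2⟩ : ∃ Q, Mᵀ * Q = 1 ∧ Q * Mᵀ = 1 :=
    ⟨(Mᵀ)⁻¹, Matrix.mul_nonsing_inv _ hdet, Matrix.nonsing_inv_mul _ hdet⟩
  let A := phaseMapEquiv h2 h1
  have hA : IsSymplecticMap A :=
    (show IsSymplecticMap (phaseMapEquiv h1 h2) from sympForm_phaseMap hMt).symm
  obtain ⟨E, hE, D, hD⟩ := exists_conj_diagonalMap hA fun ζ => by
    obtain ⟨u, s, hu, hs, hsu⟩ := exists_stable_add_stable h1 hyp.transpose ζ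
    exact ⟨s, u, hs, hu, (add_comm _ _).trans hsu⟩
  exact ⟨E, hE, A, D, fun _ => rfl, hD⟩

theorem mainTheorem6 (n : ℕ) (hn : 0 < n)
    (M : Matrix (Fin n ⊕ Fin n) (Fin n ⊕ Fin n) ℝ)
    (hM : M ∈ Matrix.symplecticGroup (Fin n) ℝ) (hyp : IsHyperbolic M) :
    ∃ E : GL (Fin n) ℝ, IsExpanding E ∧ 1 < |E.val.det| ∧
      ∀ N : ℕ, 0 < N → ∀ T : L2 n ≃ₗᵢ[ℂ] L2 n, IsMetaplectic N M T →
        (∃ V : L2 n ≃ₗᵢ[ℂ] L2 n, ∀ f : L2 n, V (T (V.symm f)) = unitaryTransferOp E f) ∧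
        ∃ c : ℂ, ‖c‖ = 1 ∧ ∃ U : L2 n ≃ₗᵢ[ℂ] L2 n,
          (∀ f : L2 n, U (c • T (U.symm f)) = unitaryTransferOp E f) ∧
          (schwartzSubspace n).map U.toLinearEquiv.toLinearMap = schwartzSubspace n := by
  obtain ⟨E, hE, A, D, hA, hD, hDA⟩ := exists_expanding_model hM hyp
  refine ⟨E, hE, one_lt_abs_det_of_isExpanding hn hE, fun N hN T hT => ?_⟩
  have hN' : (N : ℝ) ≠ 0 := by exact_mod_cast hN.ne'
  have hTA : Intertwines N A T := by
    refine Intertwines.symm (S := A.symm) (T := T.symm) fun ζ f => ?_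
    have h3 := hT.symm_heisenbergOp hN ζ (A.symm ζ) (by rw [hA]; simp [phaseMap]) (T.symm f)
    rwa [T.apply_symm_apply] at h3
  obtain ⟨U, hU, hUS⟩ := hD N hN'
  obtain ⟨c, hc, hcU⟩ := ((hU.symm.trans hTA).trans hU).exists_smul hN'
    (hDA ▸ intertwines_unitaryTransferOp (N : ℝ) E)
  refine ⟨?_, c, hc, U, fun f => ?_, hUS⟩
  · obtain ⟨Φ, hΦ⟩ := exists_unitary_conj_smul hn hE ⟨c, mem_sphere_zero_iff_norm.2 hc⟩
    refine ⟨U.trans Φ, fun f => ?_⟩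
    have hc0 : c ≠ 0 := fun h => by simp [h] at hc
    refine smul_right_injective _ hc0 ?_
    change c • Φ (U (T (U.symm (Φ.symm f)))) = c • unitaryTransferOp E f
    rw [← map_smul]
    exact (congrArg Φ (hcU (Φ.symm f))).symm.trans (hΦ f)
  · rw [map_smul, hcU]
    rfl
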